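/- Let $F(X,Y)$ be a binary form (homogeneous polynomial) with complex coefficients and degree $n \ge 3$. Writing $F(X,Y)=\prod_{i=1}^{n}(\alpha_i X-\beta_i Y)$ with $\alpha_i,\beta_i\in\mathbb{C}$, let $D_F=\prod_{i<j}(\alpha_i\beta_j-\alpha_j\beta_i)^2$ be its discriminant, and let $A_F$ be the area of the region $\{(x,y)\in\mathbb{R}^2 : |F(x,y)|\le 1\}$. If $D_F\neq 0$, then $$|D_F|^{1/(n(n-1))}\,A_F \;\le\; 3\,B\!\left(\tfrac13,\tfrac13\right),$$ where $B$ is the Beta function; in particular $A_F$ is finite. Equality holds if and only if $n=3$ and there is a nonzero $c\in\mathbb{C}$ such that the form $cF$ is equivalent to $XY(X-Y)$ under $GL_2(\mathbb{R})$, where two forms $F$ and $G$ are called equivalent under $GL_2(\mathbb{R})$ if $G(X,Y)=F(aX+bY,\,cX+dY)$ for some invertible real matrix $\begin{pmatrix} a & b\\ c& d\end{pmatrix}$. -/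

import Mathlib

open MvPolynomial MeasureTheory

/-- The binary linear form `a X - b Y` with complex coefficients, where `X = X 0`, `Y = X 1`. -/
noncomputable def linForm (a b : ℂ) : MvPolynomial (Fin 2) ℂ := C a * X 0 - C b * X 1

/-- `F = ∏ i, (α i X - β i Y)`. -/
def IsLinearFactorization {n : ℕ} (F : MvPolynomial (Fin 2) ℂ) (α β : Fin n → ℂ) : Prop :=
  F = ∏ i, linForm (α i) (β i)

/-- `∏_{i<j} (α i β j - α j β i)²`. -/
noncomputable def factorDisc {n : ℕ} (α β : Fin n → ℂ) : ℂ :=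
  ∏ i, ∏ j ∈ Finset.Ioi i, (α i * β j - α j * β i) ^ 2

open Classical in
/-- The discriminant `D_F` of a binary form `F` of degree `n`: if `F = ∏ i, (α i X - β i Y)`
then `D_F = ∏_{i<j} (α i β j - α j β i)²`. A factorization exists whenever `n ≥ 1`
(`exists_isLinearFactorization`), and the value does not depend on the one that is chosen
(`formDisc_eq`). -/
noncomputable def formDisc (n : ℕ) (F : MvPolynomial (Fin 2) ℂ) : ℂ :=
  if h : ∃ p : (Fin n → ℂ) × (Fin n → ℂ), IsLinearFactorization F p.1 p.2 then
    factorDisc h.choose.1 h.choose.2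
  else 0

/-- The area `A_F` of the region `{(x, y) ∈ ℝ² : |F(x, y)| ≤ 1}` (Lebesgue measure). -/
noncomputable def formArea (F : MvPolynomial (Fin 2) ℂ) : ENNReal :=
  volume {p : ℝ × ℝ | ‖eval ![(p.1 : ℂ), (p.2 : ℂ)] F‖ ≤ 1}

/-- `F_T(X, Y) = F(aX + bY, cX + dY)` for `T = (a b; c d)`. -/
noncomputable def formAct (F : MvPolynomial (Fin 2) ℂ) (T : GL (Fin 2) ℝ) :
    MvPolynomial (Fin 2) ℂ :=
  bind₁ (fun i => C ((T.val i 0 : ℝ) : ℂ) * X 0 + C ((T.val i 1 : ℝ) : ℂ) * X 1) F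

/-- Equivalence of binary forms under `GL₂(ℝ)`: `G = F_T` for some `T`. -/
def FormEquiv (F G : MvPolynomial (Fin 2) ℂ) : Prop := ∃ T : GL (Fin 2) ℝ, G = formAct F T

/-! The discriminant is well defined. -/

theorem eval_linForm (a b x y : ℂ) : eval ![x, y] (linForm a b) = a * x - b * y := by
  simp [linForm]

theorem coeff_linForm (a b : ℂ) :
    coeff (Finsupp.single 0 1) (linForm a b) = a ∧
      coeff (Finsupp.single 1 1) (linForm a b) = -b := by
  constructor <;> simp [linForm, coeff_C_mul, coeff_X, Finsupp.single_left_inj]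

theorem linForm_isHomogeneous (a b : ℂ) : (linForm a b).IsHomogeneous 1 := by
  unfold linForm
  refine IsHomogeneous.sub ?_ ?_
  · simpa using (isHomogeneous_C _ a).mul (isHomogeneous_X ℂ (0 : Fin 2))
  · simpa using (isHomogeneous_C _ b).mul (isHomogeneous_X ℂ (1 : Fin 2))

theorem linForm_irreducible {a b : ℂ} (h : linForm a b ≠ 0) : Irreducible (linForm a b) := by
  refine irreducible_of_totalDegree_eq_one ((linForm_isHomogeneous a b).totalDegree h) ?_
  intro x hx
  rw [isUnit_iff_ne_zero]
  rintro rfl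
  have h0 := hx (Finsupp.single 0 1)
  have h1 := hx (Finsupp.single 1 1)
  rw [(coeff_linForm a b).1, zero_dvd_iff] at h0
  rw [(coeff_linForm a b).2, zero_dvd_iff, neg_eq_zero] at h1
  exact h (by simp [linForm, h0, h1])

theorem linForm_associated {a b a' b' : ℂ} (h : Associated (linForm a b) (linForm a' b')) :
    ∃ c : ℂ, a' = c * a ∧ b' = c * b := by
  obtain ⟨u, hu⟩ := h
  obtain ⟨c, -, hc⟩ := isUnit_iff_eq_C_of_isReduced.mp u.isUnit
  rw [hc, mul_comm] at hu
  refine ⟨c, ?_, ?_⟩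
  · have := congrArg (coeff (Finsupp.single 0 1)) hu
    rw [coeff_C_mul, (coeff_linForm a b).1, (coeff_linForm a' b').1] at this
    exact this.symm
  · have := congrArg (coeff (Finsupp.single 1 1)) hu
    rw [coeff_C_mul, (coeff_linForm a b).2, (coeff_linForm a' b').2] at this
    linear_combination this

theorem linForm_smul (c a b : ℂ) : linForm (c * a) (c * b) = C c * linForm a b := by
  simp only [linForm, C_mul]; ring

theorem exists_perm_of_map_univ_eq {n : ℕ} {γ : Type*} (f g : Fin n → γ)
    (h : (Finset.univ : Finset (Fin n)).val.map f = (Finset.univ : Finset (Fin n)).val.map g) :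
    ∃ σ : Equiv.Perm (Fin n), ∀ i, g (σ i) = f i := by
  classical
  have key : ∀ c, Nonempty ({ a // f a = c } ≃ { b // g b = c }) := by
    intro c
    have := congrArg (Multiset.count c) h
    rw [Multiset.count_map, Multiset.count_map] at this
    refine ⟨Fintype.equivOfCardEq ?_⟩
    rw [Fintype.card_subtype, Fintype.card_subtype, Finset.card_def, Finset.card_def,
      Finset.filter_val, Finset.filter_val]
    simpa only [eq_comm (a := c)] using this
  exact ⟨Equiv.ofFiberEquiv fun c => (key c).some, fun i => Equiv.ofFiberEquiv_map _ i⟩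

theorem factorDisc_eq_offDiag {n : ℕ} (α β : Fin n → ℂ) :
    factorDisc α β = (∏ i : Fin n, ∏ _j ∈ Finset.Ioi i, (-1 : ℂ)) *
      ∏ i, ∏ j ∈ {i}ᶜ, (α j * β i - α i * β j) := by
  rw [← Finset.prod_prod_Ioi_mul_eq_prod_prod_off_diag (fun i j => α i * β j - α j * β i),
    ← Finset.prod_mul_distrib]
  refine Finset.prod_congr rfl fun i _ => ?_
  rw [← Finset.prod_mul_distrib]
  refine Finset.prod_congr rfl fun j _ => ?_
  ring

theorem offDiag_perm {n : ℕ} (σ : Equiv.Perm (Fin n)) (f : Fin n → Fin n → ℂ) :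
    ∏ i, ∏ j ∈ {i}ᶜ, f (σ i) (σ j) = ∏ i, ∏ j ∈ {i}ᶜ, f i j := by
  rw [← Equiv.prod_comp σ (fun i => ∏ j ∈ {i}ᶜ, f i j)]
  refine Finset.prod_congr rfl fun i _ => ?_
  exact Finset.prod_bij (fun j _ => σ j) (by simp) (by simp)
    (fun b hb => ⟨σ.symm b, by simpa [Equiv.symm_apply_eq] using hb, by simp⟩) (by simp)

theorem factorDisc_unique {n : ℕ} {F : MvPolynomial (Fin 2) ℂ} (hn : 2 ≤ n)
    {α β α' β' : Fin n → ℂ} (h : IsLinearFactorization F α β)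
    (h' : IsLinearFactorization F α' β') : factorDisc α β = factorDisc α' β' := by
  have zero_case : ∀ {a b : Fin n → ℂ}, IsLinearFactorization (0 : MvPolynomial (Fin 2) ℂ) a b →
      factorDisc a b = 0 := by
    intro a b hab
    obtain ⟨i, -, hi⟩ := Finset.prod_eq_zero_iff.mp hab.symm
    have ha : a i = 0 := by rw [← (coeff_linForm (a i) (b i)).1, hi]; simp
    have hb : b i = 0 := by
      rw [← neg_eq_zero, ← (coeff_linForm (a i) (b i)).2, hi]; simp
    rw [factorDisc_eq_offDiag]
    have : Nontrivial (Fin n) := Fin.nontrivial_iff_two_le.mpr hn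
    obtain ⟨j, hj⟩ := exists_ne i
    refine mul_eq_zero_of_right _ (Finset.prod_eq_zero (Finset.mem_univ i) ?_)
    exact Finset.prod_eq_zero (i := j) (by simpa using hj) (by simp [ha, hb])
  by_cases hF : F = 0
  · subst hF; rw [zero_case h, zero_case h']
  have hne : ∀ i, linForm (α i) (β i) ≠ 0 := fun i hi =>
    hF (h.trans (Finset.prod_eq_zero (Finset.mem_univ i) hi))
  have hne' : ∀ i, linForm (α' i) (β' i) ≠ 0 := fun i hi =>
    hF (h'.trans (Finset.prod_eq_zero (Finset.mem_univ i) hi))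
  have hrel := UniqueFactorizationMonoid.factors_unique
    (f := (Finset.univ : Finset (Fin n)).val.map fun i => linForm (α i) (β i))
    (g := (Finset.univ : Finset (Fin n)).val.map fun i => linForm (α' i) (β' i))
    (by simpa using fun i => linForm_irreducible (hne i))
    (by simpa using fun i => linForm_irreducible (hne' i))
    (by
      have e : (∏ i, linForm (α i) (β i)) = ∏ i, linForm (α' i) (β' i) := h.symm.trans h'
      rw [← Finset.prod_eq_multiset_prod, ← Finset.prod_eq_multiset_prod, e]
      exact Associated.refl _)
  rw [Associates.rel_associated_iff_map_eq_map, Multiset.map_map, Multiset.map_map] at hrel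
  obtain ⟨σ, hσ⟩ := exists_perm_of_map_univ_eq _ _ hrel
  have hc : ∀ i, ∃ c : ℂ, α' (σ i) = c * α i ∧ β' (σ i) = c * β i := fun i =>
    linForm_associated (Associates.mk_eq_mk_iff_associated.mp (hσ i).symm)
  choose c hca hcb using hc
  have hprod : ∏ i, c i = 1 := by
    have e : F = C (∏ i, c i) * F := by
      conv_lhs => rw [h', ← Equiv.prod_comp σ]
      rw [h, map_prod, ← Finset.prod_mul_distrib]
      refine Finset.prod_congr rfl fun i _ => ?_
      rw [hca, hcb, linForm_smul]
    have e2 : C (∏ i, c i) = (1 : MvPolynomial (Fin 2) ℂ) :=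
      mul_right_cancel₀ hF (by rw [← e, one_mul])
    exact C_injective (Fin 2) ℂ (e2.trans C_1.symm)
  have hc0 : ∀ i, c i ≠ 0 := fun i hi => by
    rw [Finset.prod_eq_zero (Finset.mem_univ i) hi] at hprod
    exact zero_ne_one hprod
  rw [factorDisc_eq_offDiag, factorDisc_eq_offDiag α' β',
    ← offDiag_perm σ (fun i j => α' j * β' i - α' i * β' j)]
  congr 1
  have hcc : ∏ i, ∏ j ∈ {i}ᶜ, (c i * c j) = 1 := by
    have : ∀ i, ∏ j ∈ {i}ᶜ, (c i * c j) = c i ^ (n - 1) * (c i)⁻¹ := by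
      intro i
      rw [Finset.prod_mul_distrib, Finset.prod_const, Finset.card_compl]
      congr 1
      · simp
      · have := Fintype.prod_eq_mul_prod_compl i c
        rw [hprod] at this
        exact eq_inv_of_mul_eq_one_right this.symm
    simp_rw [this, Finset.prod_mul_distrib, Finset.prod_pow, Finset.prod_inv_distrib, hprod]
    simp
  rw [← one_mul (∏ i, ∏ j ∈ {i}ᶜ, (α j * β i - α i * β j)), ← hcc, ← Finset.prod_mul_distrib]
  refine Finset.prod_congr rfl fun i _ => ?_
  rw [← Finset.prod_mul_distrib]
  refine Finset.prod_congr rfl fun j _ => ?_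
  simp only [hca, hcb]; ring

/-- Any factorization into linear forms computes the discriminant. -/
theorem formDisc_eq {n : ℕ} {F : MvPolynomial (Fin 2) ℂ} (hn : 2 ≤ n) {α β : Fin n → ℂ}
    (h : IsLinearFactorization F α β) : formDisc n F = factorDisc α β := by
  have hex : ∃ p : (Fin n → ℂ) × (Fin n → ℂ), IsLinearFactorization F p.1 p.2 := ⟨(α, β), h⟩
  rw [formDisc, dif_pos hex]
  exact factorDisc_unique hn hex.choose_spec h

/-- Evaluation of a binary form through its dehomogenization. -/
theorem eval_eq_pow_mul_eval_dehom {n : ℕ} {F : MvPolynomial (Fin 2) ℂ}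
    (hF : F.IsHomogeneous n) (x y : ℂ) (hy : y ≠ 0) :
    eval ![x, y] F = y ^ n * (aeval ![Polynomial.X, 1] F : Polynomial ℂ).eval (x / y) := by
  rw [aeval_def, eval₂_eq', Polynomial.eval_finsetSum, eval_eq', Finset.mul_sum]
  refine Finset.sum_congr rfl fun m hm => ?_
  have hd : m 0 + m 1 = n := by
    have := hF (mem_support_iff.mp hm)
    simpa [Finsupp.weight_apply, Finsupp.sum_fintype] using this
  simp only [Fin.prod_univ_two, Matrix.cons_val_zero, Matrix.cons_val_one, one_pow, mul_one,
    Polynomial.eval_mul, Polynomial.eval_pow, Polynomial.eval_X, Polynomial.algebraMap_eq,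
    Polynomial.eval_C]
  rw [← hd, pow_add, div_pow]
  field_simp

theorem natDegree_dehom_le {n : ℕ} {F : MvPolynomial (Fin 2) ℂ} (hF : F.IsHomogeneous n) :
    (aeval ![Polynomial.X, 1] F : Polynomial ℂ).natDegree ≤ n := by
  rw [aeval_def, eval₂_eq']
  refine Polynomial.natDegree_sum_le_of_forall_le _ _ fun m hm => ?_
  have hd : m 0 + m 1 = n := by
    have := hF (mem_support_iff.mp hm)
    simpa [Finsupp.weight_apply, Finsupp.sum_fintype] using this
  simp only [Fin.prod_univ_two, Matrix.cons_val_zero, Matrix.cons_val_one, one_pow, mul_one,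
    Polynomial.algebraMap_eq]
  exact (Polynomial.natDegree_C_mul_X_pow_le _ _).trans (by omega)

/-- Every complex binary form of degree `n ≥ 1` is a product of `n` linear forms. -/
theorem exists_isLinearFactorization {n : ℕ} (hn : 1 ≤ n) {F : MvPolynomial (Fin 2) ℂ}
    (hF : F.IsHomogeneous n) : ∃ α β : Fin n → ℂ, IsLinearFactorization F α β := by
  set f : Polynomial ℂ := aeval ![Polynomial.X, 1] F with hf
  have hsplit : f.Splits := IsAlgClosed.splits f
  have hdeg : f.natDegree ≤ n := natDegree_dehom_le hF
  have hcard : f.roots.card = f.natDegree := hsplit.natDegree_eq_card_roots.symm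
  set L : List (ℂ × ℂ) := f.roots.toList.map (fun r => ((1 : ℂ), r)) ++
    List.replicate (n - f.natDegree) ((0 : ℂ), (-1 : ℂ)) with hL
  have hlen : L.length = n := by simp [hL, hcard]; omega
  -- the product with the leading coefficient in front
  have hprod : F = C f.leadingCoeff * (L.map fun p => linForm p.1 p.2).prod := by
    have hev : ∀ x y : ℂ, y ≠ 0 → eval ![x, y] F =
        eval ![x, y] (C f.leadingCoeff * (L.map fun p => linForm p.1 p.2).prod) := by
      intro x y hy
      rw [eval_eq_pow_mul_eval_dehom hF x y hy, ← hf, hsplit.eval_eq_prod_roots, map_mul, eval_C,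
        map_list_prod, hL]
      simp only [List.map_append, List.map_map, List.prod_append, List.map_replicate,
        List.prod_replicate, eval_linForm]
      have h1 : ((f.roots.toList.map
          ((eval ![x, y]) ∘ (fun p : ℂ × ℂ => linForm p.1 p.2) ∘ fun r => ((1 : ℂ), r)))).prod
          = y ^ f.natDegree * (f.roots.map fun a => x / y - a).prod := by
        have aux : ∀ l : List ℂ, (l.map
            ((eval ![x, y]) ∘ (fun p : ℂ × ℂ => linForm p.1 p.2) ∘ fun r => ((1 : ℂ), r))).prod
            = y ^ l.length * (l.map fun a => x / y - a).prod := by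
          intro l
          induction l with
          | nil => simp
          | cons r l ih =>
            simp only [List.map_cons, List.prod_cons, ih, List.length_cons, Function.comp_apply,
              eval_linForm]
            field_simp
            ring
        rw [aux, Multiset.length_toList, hcard]
        conv_rhs => rw [← Multiset.coe_toList f.roots, Multiset.map_coe, Multiset.prod_coe]
      rw [h1]
      have : y ^ n = y ^ f.natDegree * y ^ (n - f.natDegree) := by
        rw [← pow_add]; congr 1; omega
      rw [this]; ring
    have hmul : F * X 1 =
        (C f.leadingCoeff * (L.map fun p => linForm p.1 p.2).prod) * X 1 := by
      refine MvPolynomial.funext fun v => ?_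
      have hv : v = ![v 0, v 1] := by ext i; fin_cases i <;> rfl
      rw [map_mul, map_mul, eval_X]
      by_cases hy : v 1 = 0
      · rw [hy, mul_zero, mul_zero]
      · rw [hv, hev _ _ hy]
    exact mul_right_cancel₀ (X_ne_zero 1) hmul
  obtain ⟨m, rfl⟩ : ∃ m, n = m + 1 := ⟨n - 1, by omega⟩
  let g : Fin (m + 1) → ℂ × ℂ := fun i => L.get (i.cast hlen.symm)
  have hg : (L.map fun p => linForm p.1 p.2).prod = ∏ i, linForm (g i).1 (g i).2 := by
    have : L = List.ofFn g := by
      refine List.ext_get (by simp [hlen]) fun k h1 h2 => ?_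
      rw [List.get_ofFn]; rfl
    conv_lhs => rw [this]
    rw [List.map_ofFn, List.prod_ofFn]; rfl
  let s : Fin (m + 1) → ℂ := Fin.cons f.leadingCoeff fun _ => 1
  refine ⟨fun i => s i * (g i).1, fun i => s i * (g i).2, ?_⟩
  unfold IsLinearFactorization
  simp_rw [linForm_smul, Finset.prod_mul_distrib]
  rw [← map_prod, ← hg, Fin.prod_univ_succ]
  simpa [s] using hprod

/-! Write `F` as a product of linear forms `L_i` and use the slope `t = x/y`. The normalized area
becomes the integral over `t` of `|D|^{1/(n(n-1))} |F(t,1)|^{-2/n}`. Two applications of Jensen's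
inequality for `exp` bound it.

Reduction to cubics. Counting how often each index and each pair occurs shows that this integrand is
the geometric mean, over ordered triples of distinct indices, of the corresponding integrands for
the cubics `L_i L_j L_k`. By AM-GM (`areaKernel_le_meanKernel`) the normalized area is at most the
average of the normalized areas of these cubics, `tripleMass`.

Reduction to real forms. Replace one factor `L` by `L + u L̄` with `|u| = 1`, which is always a
complex multiple of a real form. The mean of `log |a + u b|` over the circle is `log max (|a|,
|b|)`. For real `t` the values of `L` and `L̄` have equal modulus, so the mean of the log of the
denominator is unchanged, while the means of the logs of the brackets can only grow. Jensen then
bounds the cubic's mass by the mean mass of the mixed cubics (`tripleMass_le_lintegral_mixForm`).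
Treating the three factors in turn leaves three real forms; if they are pairwise non-proportional,
`GL₂(ℝ)` carries their product to `XY(X - Y)`, whose area is `3 B(1/3, 1/3)`.

Equality. Equality in the circle mean makes the mixed kernel constant in `u`; at the `u` where the
mixed form vanishes at `(t, 1)` this is impossible unless `L` is a multiple of a real form. Equality
in AM-GM for `n ≥ 4` makes the ratio `|L_i(t)| / |L_j(t)|` constant for two of the factors, which
their distinct real zeros forbid. -/

/-! ### Jensen's inequality for the exponential and its equality case -/

section Jensen

/-- Jensen's inequality for `exp`, for a possibly infinite right-hand side. -/
theorem ofReal_exp_integral_le_lintegral {Ω : Type*} [MeasurableSpace Ω] {μ : Measure Ω}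
    [IsProbabilityMeasure μ] {f : Ω → ℝ} (hf : Integrable f μ) :
    ENNReal.ofReal (Real.exp (∫ x, f x ∂μ)) ≤ ∫⁻ x, ENNReal.ofReal (Real.exp (f x)) ∂μ := by
  by_cases htop : ∫⁻ x, ENNReal.ofReal (Real.exp (f x)) ∂μ = ⊤
  · simp [htop]
  have hm : AEStronglyMeasurable (fun x => Real.exp (f x)) μ :=
    Real.continuous_exp.comp_aestronglyMeasurable hf.1
  have hint : Integrable (fun x => Real.exp (f x)) μ :=
    (lintegral_ofReal_ne_top_iff_integrable hm (ae_of_all _ fun x => (Real.exp_pos _).le)).1 htop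
  rw [← ofReal_integral_eq_lintegral_ofReal hint (ae_of_all _ fun x => (Real.exp_pos _).le)]
  refine ENNReal.ofReal_le_ofReal ?_
  exact convexOn_exp.map_integral_le Real.continuous_exp.continuousOn isClosed_univ
    (by simp) hf hint

/-- The tangent line to `exp` at the mean `m` lies below the graph and touches it only at `m`.
Equality forces the nonnegative gap to have integral zero, hence to vanish almost everywhere. -/
theorem ae_eq_integral_of_lintegral_exp_eq {Ω : Type*} [MeasurableSpace Ω] {μ : Measure Ω}
    [IsProbabilityMeasure μ] {f : Ω → ℝ} (hf : Integrable f μ)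
    (h : ∫⁻ x, ENNReal.ofReal (Real.exp (f x)) ∂μ ≤ ENNReal.ofReal (Real.exp (∫ x, f x ∂μ))) :
    ∀ᵐ x ∂μ, f x = ∫ x, f x ∂μ := by
  have hm : AEStronglyMeasurable (fun x => Real.exp (f x)) μ :=
    Real.continuous_exp.comp_aestronglyMeasurable hf.1
  have hint : Integrable (fun x => Real.exp (f x)) μ :=
    (lintegral_ofReal_ne_top_iff_integrable hm (ae_of_all _ fun x => (Real.exp_pos _).le)).1
      (ne_top_of_le_ne_top ENNReal.ofReal_ne_top h)
  rw [← ofReal_integral_eq_lintegral_ofReal hint (ae_of_all _ fun x => (Real.exp_pos _).le),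
    ENNReal.ofReal_le_ofReal_iff (Real.exp_pos _).le] at h
  set m := ∫ x, f x ∂μ with hmdef
  have hpos : ∀ x, 0 ≤ Real.exp (f x) - Real.exp m * (1 + (f x - m)) := fun x => by
    have h1 := Real.add_one_le_exp (f x - m)
    have h2 : Real.exp (f x) = Real.exp m * Real.exp (f x - m) := by
      rw [← Real.exp_add]; congr 1; ring
    rw [h2, ← mul_sub]
    exact mul_nonneg (Real.exp_pos _).le (by linarith)
  have hi2 : Integrable (fun x => Real.exp m * (1 + (f x - m))) μ :=
    ((integrable_const _).add (hf.sub (integrable_const _))).const_mul _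
  have hz : ∫ x, (Real.exp (f x) - Real.exp m * (1 + (f x - m))) ∂μ = 0 := by
    refine le_antisymm ?_ (integral_nonneg hpos)
    have h1 : ∫ x, (1 + (f x - m)) ∂μ = 1 := by
      have : Integrable (fun x => f x - m) μ := hf.sub (integrable_const _)
      rw [integral_add (integrable_const _) this, integral_sub hf (integrable_const _)]
      simp [← hmdef]
    rw [integral_sub hint hi2, integral_const_mul, h1]
    linarith
  rw [integral_eq_zero_iff_of_nonneg hpos (hint.sub hi2)] at hz
  filter_upwards [hz] with x hx
  by_contra hne
  have h1 := Real.add_one_lt_exp (sub_ne_zero.2 hne)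
  have h2 : Real.exp (f x) = Real.exp m * Real.exp (f x - m) := by
    rw [← Real.exp_add]; congr 1; ring
  have h3 : Real.exp m * Real.exp (f x - m) - Real.exp m * (1 + (f x - m)) = 0 := by
    rw [← h2]; exact hx
  rw [← mul_sub, mul_eq_zero] at h3
  rcases h3 with h3 | h3
  · exact (Real.exp_pos m).ne' h3
  · linarith

end Jensen

/-! ### Logarithmic means over the unit circle -/

section CircleMean

/-- The normalized Lebesgue measure on `(0, 2π]`. -/
noncomputable def angleMeasure : Measure ℝ :=
  ENNReal.ofReal (2 * Real.pi)⁻¹ • volume.restrict (Set.Ioc 0 (2 * Real.pi))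

instance : IsProbabilityMeasure angleMeasure := by
  refine ⟨?_⟩
  rw [angleMeasure, Measure.smul_apply, Measure.restrict_apply_univ, Real.volume_Ioc, smul_eq_mul,
    ← ENNReal.ofReal_mul (by positivity), sub_zero, inv_mul_cancel₀ Real.two_pi_pos.ne',
    ENNReal.ofReal_one]

theorem ae_angleMeasure_iff {p : ℝ → Prop} :
    (∀ᵐ θ ∂angleMeasure, p θ) ↔ ∀ᵐ θ ∂volume.restrict (Set.Ioc 0 (2 * Real.pi)), p θ := by
  rw [angleMeasure, Measure.ae_ennreal_smul_measure_iff]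
  simp [Real.pi_pos]

theorem integral_angleMeasure (f : ℂ → ℝ) :
    ∫ θ, f (circleMap 0 1 θ) ∂angleMeasure = Real.circleAverage f 0 1 := by
  rw [angleMeasure, integral_smul_measure, Real.circleAverage_def,
    intervalIntegral.integral_of_le Real.two_pi_pos.le, ENNReal.toReal_ofReal (by positivity)]

theorem integrable_angleMeasure {f : ℂ → ℝ} (hf : CircleIntegrable f 0 1) :
    Integrable (fun θ => f (circleMap 0 1 θ)) angleMeasure := by
  refine Integrable.smul_measure ?_ ENNReal.ofReal_ne_top
  exact (intervalIntegrable_iff_integrableOn_Ioc_of_le Real.two_pi_pos.le).1 hf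

theorem ae_circleMap_ne (z : ℂ) : ∀ᵐ θ ∂angleMeasure, circleMap 0 1 θ ≠ z := by
  rw [ae_angleMeasure_iff]
  refine ae_restrict_of_ae ?_
  have : (circleMap 0 1 ⁻¹' {z}).Countable :=
    (Set.countable_singleton z).preimage_circleMap 0 one_ne_zero
  exact measure_mono_null (fun θ hθ => by simpa using hθ) (this.measure_zero volume)

theorem ae_add_circleMap_mul_ne_zero {a b : ℂ} (h : a ≠ 0 ∨ b ≠ 0) :
    ∀ᵐ θ ∂angleMeasure, a + circleMap 0 1 θ * b ≠ 0 := by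
  by_cases hb : b = 0
  · exact ae_of_all _ fun θ => by simpa [hb] using h
  filter_upwards [ae_circleMap_ne (-a / b)] with θ hθ h0
  apply hθ
  rw [eq_div_iff hb]
  linear_combination h0

theorem integrable_log_norm_add_circleMap_mul (a b : ℂ) :
    Integrable (fun θ => Real.log ‖a + circleMap 0 1 θ * b‖) angleMeasure := by
  refine integrable_angleMeasure (f := fun z => Real.log ‖a + z * b‖) ?_
  exact MeromorphicOn.circleIntegrable_log_norm fun z _ => by fun_prop

/-- The mean value of `log |a + u b|` over the unit circle is `log max (|a|, |b|)`. -/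
theorem integral_log_norm_add_circleMap_mul (a b : ℂ) :
    ∫ θ, Real.log ‖a + circleMap 0 1 θ * b‖ ∂angleMeasure = Real.log (max ‖a‖ ‖b‖) := by
  by_cases hb : b = 0
  · simp [hb]
  -- Factoring out `b` reduces to the mean of `log |z - w|` over the unit circle, which is `log⁺
  -- |w|`.
  have h1 : ∫ θ, Real.log ‖a + circleMap 0 1 θ * b‖ ∂angleMeasure =
      ∫ θ, (Real.log ‖b‖ + Real.log ‖circleMap 0 1 θ - (-a / b)‖) ∂angleMeasure := by
    refine integral_congr_ae ?_
    filter_upwards [ae_circleMap_ne (-a / b)] with θ hθ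
    rw [← Real.log_mul (norm_ne_zero_iff.2 hb) (norm_ne_zero_iff.2 (sub_ne_zero.2 hθ)), ← norm_mul]
    congr 2
    field_simp
    ring
  have h2 := integral_angleMeasure (fun z => Real.log ‖z - (-a / b)‖)
  have hi := integrable_angleMeasure
    (circleIntegrable_log_norm_sub_const (c := 0) (a := -a / b) 1)
  rw [h1, integral_add (integrable_const _) hi, h2, circleAverage_log_norm_sub_const_eq_posLog,
    Real.posLog_eq_log_max_one (norm_nonneg _)]
  simp only [integral_const, probReal_univ, one_smul]
  have hb' : 0 < ‖b‖ := norm_pos_iff.2 hb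
  rw [← Real.log_mul hb'.ne' (by positivity)]
  congr 1
  rw [mul_max_of_nonneg _ _ hb'.le, mul_one, norm_div, norm_neg, mul_div_cancel₀ _ hb'.ne',
    max_comm]

/-- A continuous function on the circle vanishing almost everywhere vanishes. -/
theorem circle_eq_zero_of_ae {φ : ℂ → ℝ} (hφ : Continuous φ)
    (h : ∀ᵐ θ ∂angleMeasure, φ (circleMap 0 1 θ) = 0) {u : ℂ} (hu : ‖u‖ = 1) : φ u = 0 := by
  rw [ae_angleMeasure_iff] at h
  have hEq : Set.EqOn (fun θ => φ (circleMap 0 1 θ)) (fun _ => 0) (Set.Ioc 0 (2 * Real.pi)) :=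
    Measure.eqOn_Ioc_of_ae_eq volume h
      (hφ.comp (continuous_circleMap 0 1)).continuousOn continuousOn_const
  have hmem : u ∈ circleMap 0 1 '' Set.Ioc 0 (2 * Real.pi) := by
    rw [image_circleMap_Ioc]
    simpa using hu
  obtain ⟨θ, hθ, rfl⟩ := hmem
  exact hEq hθ

end CircleMean

/-! ### Area as an integral over slopes -/

section Slices

theorem lintegral_abs_Icc {r : ℝ} (hr : 0 ≤ r) :
    ∫⁻ y in Set.Icc (-r) r, ENNReal.ofReal |y| = ENNReal.ofReal (r ^ 2) := by
  rw [← restrict_Ioc_eq_restrict_Icc, ← ofReal_integral_eq_lintegral_ofReal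
    (continuous_abs.integrableOn_Ioc) (ae_of_all _ fun y => abs_nonneg y),
    ← intervalIntegral.integral_of_le (by linarith),
    ← intervalIntegral.integral_add_adjacent_intervals (b := 0)
      (continuous_abs.intervalIntegrable _ _) (continuous_abs.intervalIntegrable _ _)]
  congr 1
  have h1 : ∫ y in (-r)..0, |y| = ∫ y in (-r)..0, -y := by
    refine intervalIntegral.integral_congr fun y hy => ?_
    rw [Set.uIcc_of_le (by linarith)] at hy
    exact abs_of_nonpos hy.2
  have h2 : ∫ y in (0 : ℝ)..r, |y| = ∫ y in (0 : ℝ)..r, y := by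
    refine intervalIntegral.integral_congr fun y hy => ?_
    rw [Set.uIcc_of_le hr] at hy
    exact abs_of_nonneg hy.1
  rw [h1, h2, intervalIntegral.integral_neg, integral_id, integral_id]
  ring

/-- The area of `{f ≤ 1}` for a nonnegative homogeneous function `f` of degree `n` on the plane, as
an integral over the slope. -/
theorem volume_le_one_eq_lintegral {n : ℕ} (hn : n ≠ 0) {f : ℝ × ℝ → ℝ} (hf : Measurable f)
    (hhom : ∀ t y : ℝ, f (t * y, y) = |y| ^ n * f (t, 1))
    (hpos : ∀ᵐ t : ℝ, 0 < f (t, 1)) :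
    volume {p : ℝ × ℝ | f p ≤ 1} = ∫⁻ t : ℝ, ENNReal.ofReal (f (t, 1) ^ (-2 / (n : ℝ))) := by
  have hS : MeasurableSet {p : ℝ × ℝ | f p ≤ 1} := measurableSet_le hf measurable_const
  -- Integrand after the substitution `x = t y` on each horizontal line; the factor `|y|` is its
  -- Jacobian. Tonelli then allows integrating over `y` first.
  let φ : ℝ → ℝ → ENNReal := fun y t =>
    {q : ℝ × ℝ | |q.1| ^ n * f (q.2, 1) ≤ 1}.indicator (fun q => ENNReal.ofReal |q.1|) (y, t)
  have hφm : Measurable (Function.uncurry φ) := by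
    have h1 : Measurable fun q : ℝ × ℝ => |q.1| ^ n * f (q.2, 1) := by fun_prop
    have h2 : Measurable fun q : ℝ × ℝ => ENNReal.ofReal |q.1| := by fun_prop
    exact h2.indicator (measurableSet_le h1 measurable_const)
  have hy : ∀ᵐ y : ℝ, volume ((fun x => (x, y)) ⁻¹' {p : ℝ × ℝ | f p ≤ 1}) = ∫⁻ t, φ y t := by
    filter_upwards [Measure.ae_ne volume (0 : ℝ)] with y hy0
    have hm : MeasurableSet {t : ℝ | |y| ^ n * f (t, 1) ≤ 1} :=
      measurableSet_le (by fun_prop) measurable_const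
    have e1 : ∫⁻ t, φ y t = ENNReal.ofReal |y| * volume {t : ℝ | |y| ^ n * f (t, 1) ≤ 1} := by
      rw [← lintegral_indicator_const hm]
      rfl
    have e2 : {t : ℝ | |y| ^ n * f (t, 1) ≤ 1} =
        (fun t => t * y) ⁻¹' ((fun x => (x, y)) ⁻¹' {p : ℝ × ℝ | f p ≤ 1}) := by
      ext t
      simp only [Set.mem_ofPred_eq, Set.mem_preimage, hhom]
    rw [e1, e2, Real.volume_preimage_mul_right hy0, ← mul_assoc,
      ← ENNReal.ofReal_mul (abs_nonneg y), ← abs_mul, mul_inv_cancel₀ hy0]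
    simp
  rw [Measure.volume_eq_prod, Measure.prod_apply_symm hS, lintegral_congr_ae hy,
    lintegral_lintegral_swap hφm.aemeasurable]
  refine lintegral_congr_ae ?_
  filter_upwards [hpos] with t ht
  have hset : {y : ℝ | |y| ^ n * f (t, 1) ≤ 1} =
      Set.Icc (-(f (t, 1) ^ (-1 / (n : ℝ)))) (f (t, 1) ^ (-1 / (n : ℝ))) := by
    ext y
    have hpow : (f (t, 1) ^ (-1 / (n : ℝ))) ^ n = (f (t, 1))⁻¹ := by
      rw [← Real.rpow_natCast, ← Real.rpow_mul ht.le, div_mul_cancel₀ _ (Nat.cast_ne_zero.2 hn),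
        Real.rpow_neg_one]
    rw [Set.mem_ofPred_eq, Set.mem_Icc, ← abs_le, ← pow_le_pow_iff_left₀ (abs_nonneg y)
      (Real.rpow_nonneg ht.le _) hn, hpow,
      ← one_div, le_div_iff₀ ht]
  have hind : ∀ y, φ y t = ({y : ℝ | |y| ^ n * f (t, 1) ≤ 1}).indicator
      (fun y => ENNReal.ofReal |y|) y := fun y => rfl
  simp_rw [hind]
  rw [lintegral_indicator (by rw [hset]; exact measurableSet_Icc), hset,
    lintegral_abs_Icc (Real.rpow_nonneg ht.le _), ← Real.rpow_natCast, ← Real.rpow_mul ht.le]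
  congr 2
  push_cast
  ring

end Slices

/-! ### The area for `XY(X - Y)` -/

section BetaIntegral

/-- The integrand of the area of `XY(X - Y)`. -/
noncomputable def betaKernel (t : ℝ) : ENNReal :=
  ENNReal.ofReal (|t * (t - 1)| ^ (-2 / 3 : ℝ))

theorem setLIntegral_betaKernel_Ioo :
    ∫⁻ t in Set.Ioo 0 1, betaKernel t = ENNReal.ofReal (ProbabilityTheory.beta (1 / 3) (1 / 3)) := by
  have hb : 0 < ProbabilityTheory.beta (1 / 3) (1 / 3) :=
    ProbabilityTheory.beta_pos (by norm_num) (by norm_num)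
  have h := ProbabilityTheory.lintegral_betaPDF_eq_one (α := 1 / 3) (β := 1 / 3)
    (by norm_num) (by norm_num)
  rw [ProbabilityTheory.lintegral_betaPDF] at h
  -- On `(0, 1)` the kernel is the unnormalized density of the Beta distribution with both
  -- parameters `1/3`, since `1/3 - 1 = -2/3`.
  have h2 : ∫⁻ t in Set.Ioo 0 1, betaKernel t =
      ∫⁻ x in Set.Ioo (0 : ℝ) 1, ENNReal.ofReal (ProbabilityTheory.beta (1 / 3) (1 / 3)) *
        ENNReal.ofReal (1 / ProbabilityTheory.beta (1 / 3) (1 / 3) * x ^ ((1 / 3 : ℝ) - 1) *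
          (1 - x) ^ ((1 / 3 : ℝ) - 1)) := by
    refine setLIntegral_congr_fun measurableSet_Ioo fun x hx => ?_
    simp only [betaKernel]
    rw [← ENNReal.ofReal_mul hb.le]
    congr 1
    have hx1 : |x * (x - 1)| = x * (1 - x) := by
      rw [abs_of_nonpos (mul_nonpos_of_nonneg_of_nonpos hx.1.le (by linarith [hx.2]))]; ring
    rw [hx1, Real.mul_rpow hx.1.le (by linarith [hx.2])]
    norm_num
    field_simp
  rw [h2, lintegral_const_mul' _ _ ENNReal.ofReal_ne_top, h, mul_one]

/-- The zeros `0`, `1`, `∞` of `XY(X - Y)` cut the projective line into three intervals, permuted by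
real projective maps preserving the form up to sign. Here `t ↦ 1/t` exchanges `(0, 1)` and `(1, ∞)`;
`t ↦ 1 - t` handles the remaining interval. -/
theorem setLIntegral_betaKernel_Ioi :
    ∫⁻ t in Set.Ioi 1, betaKernel t = ∫⁻ t in Set.Ioo 0 1, betaKernel t := by
  have himg : (fun t : ℝ => t⁻¹) '' Set.Ioo 0 1 = Set.Ioi 1 := by
    ext y
    constructor
    · rintro ⟨t, ht, rfl⟩
      exact (one_lt_inv₀ ht.1).2 ht.2
    · intro hy
      have hy' : (1 : ℝ) < y := hy
      exact ⟨y⁻¹, ⟨by positivity, inv_lt_one_of_one_lt₀ hy'⟩, inv_inv y⟩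
  rw [← himg, lintegral_image_eq_lintegral_abs_deriv_mul measurableSet_Ioo
    (f' := fun t => -(t ^ 2)⁻¹)
    (fun t ht => (hasDerivAt_inv ht.1.ne').hasDerivWithinAt) inv_injective.injOn]
  refine setLIntegral_congr_fun measurableSet_Ioo fun t ht => ?_
  simp only [betaKernel]
  rw [← ENNReal.ofReal_mul (abs_nonneg _)]
  congr 1
  have ht0 := ht.1
  have e1 : |t⁻¹ * (t⁻¹ - 1)| = |t * (t - 1)| * t ^ (-3 : ℝ) := by
    rw [← abs_of_pos (Real.rpow_pos_of_pos ht0 (-3)), ← abs_mul, ← abs_neg]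
    congr 1
    rw [show (-3 : ℝ) = ((-3 : ℤ) : ℝ) by norm_num, Real.rpow_intCast]
    field_simp
    ring
  rw [e1, Real.mul_rpow (abs_nonneg _) (by positivity), ← Real.rpow_mul ht0.le, abs_neg,
    abs_of_pos (by positivity)]
  norm_num
  field_simp

theorem setLIntegral_betaKernel_Iio :
    ∫⁻ t in Set.Iio 0, betaKernel t = ∫⁻ t in Set.Ioi 1, betaKernel t := by
  have himg : (fun t : ℝ => 1 - t) '' Set.Ioi 1 = Set.Iio 0 := by
    simp
  rw [← himg, lintegral_image_eq_lintegral_abs_deriv_mul measurableSet_Ioi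
    (f := fun t => 1 - t) (f' := fun _ => -1)
    (fun t _ => ((hasDerivAt_id t).const_sub 1).hasDerivWithinAt)
    (sub_right_injective).injOn]
  refine setLIntegral_congr_fun measurableSet_Ioi fun t _ => ?_
  simp only [betaKernel]
  rw [show (1 - t) * (1 - t - 1) = t * (t - 1) by ring]
  simp

theorem lintegral_betaKernel :
    ∫⁻ t, betaKernel t = ENNReal.ofReal (3 * ProbabilityTheory.beta (1 / 3) (1 / 3)) := by
  have h0 : ∫⁻ t in Set.Iic 0, betaKernel t = ∫⁻ t in Set.Iio 0, betaKernel t := by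
    rw [restrict_Iio_eq_restrict_Iic]
  have h1 : ∫⁻ t in Set.Ioi 0, betaKernel t =
      (∫⁻ t in Set.Ioo 0 1, betaKernel t) + ∫⁻ t in Set.Ioi 1, betaKernel t := by
    rw [← Set.Ioc_union_Ioi_eq_Ioi (zero_le_one (α := ℝ)),
      lintegral_union measurableSet_Ioi (Set.Ioc_disjoint_Ioi le_rfl),
      restrict_Ioo_eq_restrict_Ioc]
  have hb : 0 < ProbabilityTheory.beta (1 / 3) (1 / 3) :=
    ProbabilityTheory.beta_pos (by norm_num) (by norm_num)
  rw [← lintegral_add_compl _ (measurableSet_Iic (a := (0 : ℝ))), Set.compl_Iic, h0, h1,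
    setLIntegral_betaKernel_Iio, setLIntegral_betaKernel_Ioi, setLIntegral_betaKernel_Ioo,
    ← ENNReal.ofReal_add hb.le hb.le, ← ENNReal.ofReal_add hb.le (by positivity)]
  congr 1
  ring

/-- The area of `{|xy(x - y)| ≤ 1}`. -/
theorem volume_abs_mul_mul_sub_le_one :
    volume {p : ℝ × ℝ | |p.1 * p.2 * (p.1 - p.2)| ≤ 1} =
      ENNReal.ofReal (3 * ProbabilityTheory.beta (1 / 3) (1 / 3)) := by
  rw [← lintegral_betaKernel, volume_le_one_eq_lintegral (n := 3) (by norm_num)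
    (f := fun p => |p.1 * p.2 * (p.1 - p.2)|) (by fun_prop)]
  · simp [betaKernel]
  · intro t y
    rw [← abs_pow, ← abs_mul]
    congr 1
    ring
  · filter_upwards [Measure.ae_ne volume (0 : ℝ), Measure.ae_ne volume (1 : ℝ)] with t h0 h1
    rw [abs_pos]
    exact mul_ne_zero (mul_ne_zero h0 one_ne_zero) (sub_ne_zero.2 h1)

end BetaIntegral

/-! ### Linear forms and the normalized area of a product of three -/

section LinearForms

/-- The bracket `p₁ q₂ - q₁ p₂` of the linear forms `p₁ X - p₂ Y` and `q₁ X - q₂ Y`. -/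
def bracket (p q : ℂ × ℂ) : ℂ := p.1 * q.2 - q.1 * p.2

/-- The value of the linear form `p₁ X - p₂ Y` at `(t, 1)`. -/
def slopeEval (p : ℂ × ℂ) (t : ℝ) : ℂ := p.1 * t - p.2

theorem norm_bracket_comm (p q : ℂ × ℂ) : ‖bracket p q‖ = ‖bracket q p‖ := by
  rw [← norm_neg]; congr 1; simp only [bracket]; ring

theorem ne_zero_of_bracket_ne_zero {p q : ℂ × ℂ} (h : bracket p q ≠ 0) : p ≠ 0 := by
  rintro rfl; simp [bracket] at h

theorem bracket_ne_zero_comm {p q : ℂ × ℂ} (h : bracket p q ≠ 0) : bracket q p ≠ 0 := by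
  rwa [← norm_ne_zero_iff, norm_bracket_comm, norm_ne_zero_iff]

theorem ae_slopeEval_ne_zero {p : ℂ × ℂ} (hp : p ≠ 0) : ∀ᵐ t : ℝ, slopeEval p t ≠ 0 := by
  by_cases h1 : p.1 = 0
  · refine ae_of_all _ fun t ht => hp ?_
    simp only [slopeEval, h1, zero_mul, zero_sub, neg_eq_zero] at ht
    exact Prod.ext h1 ht
  filter_upwards [Measure.ae_ne volume (p.2 / p.1).re] with t ht h0
  apply ht
  have : (t : ℂ) = p.2 / p.1 := by
    rw [eq_div_iff h1]; simp only [slopeEval] at h0; linear_combination h0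
  rw [← this, Complex.ofReal_re]

theorem continuous_slopeEval (p : ℂ × ℂ) : Continuous (slopeEval p) := by
  unfold slopeEval; fun_prop

/-- Two linear forms with a common zero at `(t, 1)` are proportional. -/
theorem bracket_eq_zero_of_slopeEval {p q : ℂ × ℂ} {t : ℝ} (hp : slopeEval p t = 0)
    (hq : slopeEval q t = 0) : bracket p q = 0 := by
  simp only [slopeEval] at hp hq
  simp only [bracket]
  linear_combination q.1 * hp - p.1 * hq

theorem slopeEval_eq_zero_of_bracket {p q : ℂ × ℂ} {t : ℝ} (hp0 : p ≠ 0) (hp : slopeEval p t = 0)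
    (hpq : bracket p q = 0) : slopeEval q t = 0 := by
  simp only [slopeEval, bracket] at *
  have h1 : p.1 ≠ 0 := by
    intro h1
    apply hp0
    refine Prod.ext h1 ?_
    simpa [h1] using hp
  apply mul_left_cancel₀ h1
  linear_combination q.1 * hp - hpq

/-- A complex multiple of a linear form with real coefficients. -/
def IsRealMultiple (p : ℂ × ℂ) : Prop := ∃ (c : ℂ) (a b : ℝ), p = (c * a, c * b)

/-- `|D|^{1/6} |F(t, 1)|^{-2/3}` for the product `F` of the linear forms `p`, `q`, `r`. -/
noncomputable def tripleKernel (p q r : ℂ × ℂ) (t : ℝ) : ℝ :=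
  (‖bracket p q‖ * ‖bracket p r‖ * ‖bracket q r‖) ^ (1 / 3 : ℝ) *
    (‖slopeEval p t‖ * ‖slopeEval q t‖ * ‖slopeEval r t‖) ^ (-2 / 3 : ℝ)

/-- `|D|^{1/6} A` for the product of the linear forms `p`, `q`, `r`. -/
noncomputable def tripleMass (p q r : ℂ × ℂ) : ENNReal :=
  ∫⁻ t, ENNReal.ofReal (tripleKernel p q r t)

theorem tripleMass_comm₁₂ (p q r : ℂ × ℂ) : tripleMass p q r = tripleMass q p r := by
  unfold tripleMass tripleKernel
  rw [norm_bracket_comm p q]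
  refine lintegral_congr fun t => ?_
  rw [mul_right_comm ‖bracket q p‖, mul_comm ‖slopeEval p t‖]

theorem tripleMass_comm₂₃ (p q r : ℂ × ℂ) : tripleMass p q r = tripleMass p r q := by
  unfold tripleMass tripleKernel
  rw [norm_bracket_comm q r]
  refine lintegral_congr fun t => ?_
  rw [mul_comm ‖bracket p q‖, mul_right_comm ‖slopeEval p t‖]

/-- Degenerate triples thus satisfy the cubic bound trivially, so no care is needed when mixing
makes two factors proportional. -/
theorem tripleMass_eq_zero {p q r : ℂ × ℂ}
    (h : bracket p q = 0 ∨ bracket p r = 0 ∨ bracket q r = 0) : tripleMass p q r = 0 := by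
  have : ‖bracket p q‖ * ‖bracket p r‖ * ‖bracket q r‖ = 0 := by
    rcases h with h | h | h <;> simp [h]
  unfold tripleMass tripleKernel
  rw [this, Real.zero_rpow (by norm_num)]
  simp

theorem tripleKernel_eq_exp {p q r : ℂ × ℂ} {t : ℝ} (hpq : bracket p q ≠ 0) (hpr : bracket p r ≠ 0)
    (hqr : bracket q r ≠ 0) (hp : slopeEval p t ≠ 0) (hq : slopeEval q t ≠ 0)
    (hr : slopeEval r t ≠ 0) :
    tripleKernel p q r t = Real.exp (1 / 3 * (Real.log ‖bracket p q‖ + Real.log ‖bracket p r‖ +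
      Real.log ‖bracket q r‖) - 2 / 3 * (Real.log ‖slopeEval p t‖ + Real.log ‖slopeEval q t‖ +
      Real.log ‖slopeEval r t‖)) := by
  rw [← norm_ne_zero_iff] at *
  rw [tripleKernel, Real.rpow_def_of_pos (by positivity), Real.rpow_def_of_pos (by positivity),
    ← Real.exp_add, Real.log_mul (by positivity) hqr, Real.log_mul hpq hpr,
    Real.log_mul (by positivity) hr, Real.log_mul hp hq]
  congr 1
  ring

/-- A factor occurs in two brackets and in one value, and `2 · (1/3) - 2/3 = 0`. -/
theorem tripleMass_smul {c : ℂ} (hc : c ≠ 0) (p q r : ℂ × ℂ) :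
    tripleMass (c * p.1, c * p.2) q r = tripleMass p q r := by
  have h1 : ∀ s, bracket (c * p.1, c * p.2) s = c * bracket p s := fun s => by
    simp only [bracket]; ring
  have h2 : ∀ t, slopeEval (c * p.1, c * p.2) t = c * slopeEval p t := fun t => by
    simp only [slopeEval]; ring
  unfold tripleMass tripleKernel
  refine lintegral_congr fun t => ?_
  congr 1
  have hc' : 0 < ‖c‖ := norm_pos_iff.2 hc
  simp only [h1, h2, norm_mul]
  rw [show ‖c‖ * ‖bracket p q‖ * (‖c‖ * ‖bracket p r‖) * ‖bracket q r‖ =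
      ‖c‖ ^ 2 * (‖bracket p q‖ * ‖bracket p r‖ * ‖bracket q r‖) by ring,
    show ‖c‖ * ‖slopeEval p t‖ * ‖slopeEval q t‖ * ‖slopeEval r t‖ =
      ‖c‖ * (‖slopeEval p t‖ * ‖slopeEval q t‖ * ‖slopeEval r t‖) by ring,
    Real.mul_rpow (x := ‖c‖ ^ 2) (by positivity) (by positivity),
    Real.mul_rpow (x := ‖c‖) (by positivity) (by positivity)]
  have h3 : (‖c‖ ^ 2) ^ (1 / 3 : ℝ) * ‖c‖ ^ (-2 / 3 : ℝ) = 1 := by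
    rw [← Real.rpow_natCast, ← Real.rpow_mul hc'.le, ← Real.rpow_add hc']
    norm_num
  linear_combination (‖bracket p q‖ * ‖bracket p r‖ * ‖bracket q r‖) ^ (1 / 3 : ℝ) *
    (‖slopeEval p t‖ * ‖slopeEval q t‖ * ‖slopeEval r t‖) ^ (-2 / 3 : ℝ) * h3

/-- The area of the region where the product of three linear forms is at most `1`. -/
theorem tripleMass_eq_volume {p q r : ℂ × ℂ} (hp : p ≠ 0) (hq : q ≠ 0) (hr : r ≠ 0) :
    tripleMass p q r =
      ENNReal.ofReal ((‖bracket p q‖ * ‖bracket p r‖ * ‖bracket q r‖) ^ (1 / 3 : ℝ)) *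
        volume {v : ℝ × ℝ | ‖(p.1 * v.1 - p.2 * v.2) * (q.1 * v.1 - q.2 * v.2) *
          (r.1 * v.1 - r.2 * v.2)‖ ≤ 1} := by
  rw [volume_le_one_eq_lintegral (n := 3) (by norm_num)
    (f := fun v : ℝ × ℝ => ‖(p.1 * v.1 - p.2 * v.2) * (q.1 * v.1 - q.2 * v.2) *
          (r.1 * v.1 - r.2 * v.2)‖) (by fun_prop), ← lintegral_const_mul' _ _ ENNReal.ofReal_ne_top]
  · refine lintegral_congr fun t => ?_
    rw [← ENNReal.ofReal_mul (by positivity), tripleKernel]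
    simp [slopeEval]
  · intro t y
    rw [← Real.norm_eq_abs, ← Complex.norm_real, ← norm_pow, ← norm_mul]
    congr 1
    push_cast
    ring
  · filter_upwards [ae_slopeEval_ne_zero hp, ae_slopeEval_ne_zero hq, ae_slopeEval_ne_zero hr]
      with t h1 h2 h3
    simp only [slopeEval] at h1 h2 h3
    simp [h1, h2, h3]

end LinearForms

/-! ### Triples of real forms -/

section RealForms

/-- The linear map `(x, y) ↦ (a x + b y, c x + d y)` of the plane. -/
def planeMap (a b c d : ℝ) : ℝ × ℝ →ₗ[ℝ] ℝ × ℝ :=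
  (a • LinearMap.fst ℝ ℝ ℝ + b • LinearMap.snd ℝ ℝ ℝ).prod
    (c • LinearMap.fst ℝ ℝ ℝ + d • LinearMap.snd ℝ ℝ ℝ)

theorem planeMap_apply (a b c d : ℝ) (v : ℝ × ℝ) :
    planeMap a b c d v = (a * v.1 + b * v.2, c * v.1 + d * v.2) := rfl

theorem det_planeMap (a b c d : ℝ) : LinearMap.det (planeMap a b c d) = a * d - b * c := by
  rw [← LinearMap.det_toMatrix (Module.Basis.finTwoProd ℝ), Matrix.det_fin_two]
  simp [LinearMap.toMatrix_apply, planeMap_apply]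

/-- A real linear change of variables takes the product of the three forms to `± XY(X - Y)`; its
determinant cancels the bracket factor exactly. -/
theorem tripleMass_ofReal {a₁ b₁ a₂ b₂ a₃ b₃ : ℝ} (h12 : a₁ * b₂ - a₂ * b₁ ≠ 0)
    (h13 : a₁ * b₃ - a₃ * b₁ ≠ 0) (h23 : a₂ * b₃ - a₃ * b₂ ≠ 0) :
    tripleMass ((a₁ : ℂ), (b₁ : ℂ)) (a₂, b₂) (a₃, b₃) =
      ENNReal.ofReal (3 * ProbabilityTheory.beta (1 / 3) (1 / 3)) := by
  have hne : ∀ {a b c d : ℝ}, a * d - c * b ≠ 0 → ((a : ℂ), (b : ℂ)) ≠ 0 ∧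
      ((c : ℂ), (d : ℂ)) ≠ 0 := by
    intro a b c d h
    simp only [ne_eq, Prod.mk_eq_zero, Complex.ofReal_eq_zero]
    constructor <;> rintro ⟨rfl, rfl⟩ <;> simp at h
  have hbr : ∀ a b c d : ℝ, ‖bracket ((a : ℂ), (b : ℂ)) (c, d)‖ = |a * d - c * b| := by
    intro a b c d
    rw [← Real.norm_eq_abs, ← Complex.norm_real]
    simp [bracket]
  rw [tripleMass_eq_volume (hne h12).1 (hne h12).2 (hne h13).2, hbr, hbr, hbr]
  set D := a₁ * b₂ - a₂ * b₁ with hD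
  -- Cramer's rule: the third form is `P` times the first plus `Q` times the second.
  set P := -(a₂ * b₃ - a₃ * b₂) / D with hP
  set Q := (a₁ * b₃ - a₃ * b₁) / D with hQ
  have hP0 : P ≠ 0 := div_ne_zero (neg_ne_zero.2 h23) h12
  have hQ0 : Q ≠ 0 := div_ne_zero h13 h12
  have ha3 : a₃ = P * a₁ + Q * a₂ := by
    rw [hP, hQ]; field_simp; rw [hD]; ring
  have hb3 : b₃ = P * b₁ + Q * b₂ := by
    rw [hP, hQ]; field_simp; rw [hD]; ring
  set k := |P * Q| ^ (-1 / 3 : ℝ) with hk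
  have hPQ : 0 < |P * Q| := abs_pos.2 (mul_ne_zero hP0 hQ0)
  have hk0 : 0 < k := Real.rpow_pos_of_pos hPQ _
  have hk3 : k ^ 3 * |P * Q| = 1 := by
    rw [hk, ← Real.rpow_natCast, ← Real.rpow_mul hPQ.le,
      show (-1 / 3 : ℝ) * ((3 : ℕ) : ℝ) = -1 by norm_num, Real.rpow_neg_one,
      inv_mul_cancel₀ hPQ.ne']
  -- The new coordinates are `x = k P L₁` and `y = -k Q L₂`, so that `x - y = k L₃`. The choice `k³
  -- |P Q| = 1` makes `|x y (x - y)| = |L₁ L₂ L₃|`.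
  set T := planeMap (k * P * a₁) (-(k * P * b₁)) (-(k * Q * a₂)) (k * Q * b₂) with hT
  have hdet : LinearMap.det T = k ^ 2 * (P * Q) * D := by
    rw [hT, det_planeMap, hD]; ring
  have hdet0 : LinearMap.det T ≠ 0 := by
    rw [hdet]; positivity
  have hset : {v : ℝ × ℝ | ‖((a₁ : ℂ) * v.1 - b₁ * v.2) * (a₂ * v.1 - b₂ * v.2) *
      (a₃ * v.1 - b₃ * v.2)‖ ≤ 1} = T ⁻¹' {p : ℝ × ℝ | |p.1 * p.2 * (p.1 - p.2)| ≤ 1} := by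
    ext v
    simp only [Set.mem_ofPred_eq, Set.mem_preimage, hT, planeMap_apply]
    have e1 : ‖((a₁ : ℂ) * v.1 - b₁ * v.2) * (a₂ * v.1 - b₂ * v.2) * (a₃ * v.1 - b₃ * v.2)‖ =
        |(a₁ * v.1 - b₁ * v.2) * (a₂ * v.1 - b₂ * v.2) * (a₃ * v.1 - b₃ * v.2)| := by
      rw [← Real.norm_eq_abs, ← Complex.norm_real]
      push_cast
      rfl
    have e2 : (k * P * a₁ * v.1 + -(k * P * b₁) * v.2) * (-(k * Q * a₂) * v.1 + k * Q * b₂ * v.2) *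
        (k * P * a₁ * v.1 + -(k * P * b₁) * v.2 - (-(k * Q * a₂) * v.1 + k * Q * b₂ * v.2)) =
        -(k ^ 3 * (P * Q)) * ((a₁ * v.1 - b₁ * v.2) * (a₂ * v.1 - b₂ * v.2) *
          (a₃ * v.1 - b₃ * v.2)) := by
      rw [ha3, hb3]; ring
    have e3 : |-(k ^ 3 * (P * Q))| = 1 := by
      rw [abs_neg, abs_mul, abs_of_pos (pow_pos hk0 3), hk3]
    rw [e1, e2, abs_mul (-(k ^ 3 * (P * Q))), e3, one_mul]
  rw [hset, Measure.addHaar_preimage_linearMap _ hdet0, volume_abs_mul_mul_sub_le_one, ← mul_assoc,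
    ← ENNReal.ofReal_mul (by positivity)]
  convert one_mul _
  rw [ENNReal.ofReal_eq_one]
  have h13' : a₁ * b₃ - a₃ * b₁ = Q * D := by rw [hQ, div_mul_cancel₀ _ h12]
  have h23' : a₂ * b₃ - a₃ * b₂ = -(P * D) := by rw [hP, div_mul_cancel₀ _ h12, neg_neg]
  have hD0 : 0 < |D| := abs_pos.2 h12
  -- Inserting the factor `(k³ |P Q|)² = 1` turns the product of the brackets into the cube of `|det
  -- T|`.
  have hcube : |D| * |Q * D| * |-(P * D)| = (k ^ 2 * |P * Q| * |D|) ^ 3 := by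
    have : |D| * |Q * D| * |-(P * D)| = |P * Q| * |D| ^ 3 * (k ^ 3 * |P * Q|) ^ 2 := by
      rw [hk3, abs_neg, abs_mul, abs_mul, abs_mul]; ring
    rw [this]; ring
  have hdet' : |k ^ 2 * (P * Q) * D| = k ^ 2 * |P * Q| * |D| := by
    rw [abs_mul, abs_mul (k ^ 2), abs_of_pos (pow_pos hk0 2)]
  rw [h13', h23', hcube, ← Real.rpow_natCast, ← Real.rpow_mul (by positivity),
    show ((3 : ℕ) : ℝ) * (1 / 3) = 1 by norm_num, Real.rpow_one, hdet, abs_inv, hdet',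
    mul_inv_cancel₀ (by positivity)]

theorem tripleMass_of_isRealMultiple {p q r : ℂ × ℂ} (hp : IsRealMultiple p)
    (hq : IsRealMultiple q) (hr : IsRealMultiple r) (hpq : bracket p q ≠ 0)
    (hpr : bracket p r ≠ 0) (hqr : bracket q r ≠ 0) :
    tripleMass p q r = ENNReal.ofReal (3 * ProbabilityTheory.beta (1 / 3) (1 / 3)) := by
  obtain ⟨c₁, a₁, b₁, rfl⟩ := hp
  obtain ⟨c₂, a₂, b₂, rfl⟩ := hq
  obtain ⟨c₃, a₃, b₃, rfl⟩ := hr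
  have hbr : ∀ (c d : ℂ) (a b a' b' : ℝ), bracket (c * a, c * b) (d * a', d * b') =
      c * d * ((a * b' - a' * b : ℝ) : ℂ) := by
    intro c d a b a' b'
    simp only [bracket]; push_cast; ring
  rw [hbr, mul_ne_zero_iff, mul_ne_zero_iff, Complex.ofReal_ne_zero] at hpq hpr hqr
  -- The scaling lemma acts on the first slot, so each factor is moved there, stripped of its
  -- complex scalar and moved back.
  rw [tripleMass_smul hpq.1.1 ((a₁ : ℂ), (b₁ : ℂ)), tripleMass_comm₁₂,
    tripleMass_smul hpq.1.2 ((a₂ : ℂ), (b₂ : ℂ)), tripleMass_comm₁₂, tripleMass_comm₂₃,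
    tripleMass_comm₁₂, tripleMass_smul hpr.1.2 ((a₃ : ℂ), (b₃ : ℂ)), tripleMass_comm₁₂,
    tripleMass_comm₂₃]
  exact tripleMass_ofReal hpq.2 hpr.2 hqr.2

end RealForms

/-! ### Averaging over `L + u L̄` -/

section Mixing

/-- The linear form `L + u L̄`, where `L̄` has the conjugate coefficients of `L`. -/
noncomputable def mixForm (p : ℂ × ℂ) (u : ℂ) : ℂ × ℂ :=
  (p.1 + u * (starRingEnd ℂ) p.1, p.2 + u * (starRingEnd ℂ) p.2)

theorem bracket_mixForm (p q : ℂ × ℂ) (u : ℂ) : bracket (mixForm p u) q =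
    bracket p q + u * bracket ((starRingEnd ℂ) p.1, (starRingEnd ℂ) p.2) q := by
  simp only [bracket, mixForm]; ring

/-- Since `t` is real, the value of `L̄` at `(t, 1)` is the conjugate of that of `L`. The two moduli
agree, so the circle mean of the log of the mixed value is exactly `log |L(t, 1)|`. -/
theorem slopeEval_mixForm (p : ℂ × ℂ) (u : ℂ) (t : ℝ) :
    slopeEval (mixForm p u) t = slopeEval p t + u * (starRingEnd ℂ) (slopeEval p t) := by
  simp only [slopeEval, mixForm, map_sub, map_mul, Complex.conj_ofReal]; ring

theorem exists_sq_eq_of_norm_eq_one {u : ℂ} (hu : ‖u‖ = 1) :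
    ∃ w : ℂ, w ^ 2 = u ∧ w * (starRingEnd ℂ) w = 1 := by
  obtain ⟨w, hw⟩ := IsAlgClosed.exists_pow_nat_eq u (n := 2) (by norm_num)
  refine ⟨w, hw, ?_⟩
  have : ‖w‖ = 1 := by
    rw [← hw, norm_pow] at hu
    exact (pow_eq_one_iff_of_nonneg (norm_nonneg w) two_ne_zero).1 hu
  rw [Complex.mul_conj, Complex.normSq_eq_norm_sq, this]
  simp

/-- With `u = w²` and `|w| = 1`, one has `z + w² z̄ = w (w̄ z + w z̄) = w · 2 Re (w̄ z)`, with the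
same `w` for both coefficients. -/
theorem isRealMultiple_mixForm (p : ℂ × ℂ) {u : ℂ} (hu : ‖u‖ = 1) :
    IsRealMultiple (mixForm p u) := by
  obtain ⟨w, rfl, hw⟩ := exists_sq_eq_of_norm_eq_one hu
  have key : ∀ z : ℂ, z + w ^ 2 * (starRingEnd ℂ) z =
      w * ((2 * ((starRingEnd ℂ) w * z).re : ℝ) : ℂ) := by
    intro z
    have := Complex.add_conj ((starRingEnd ℂ) w * z)
    push_cast at this ⊢
    rw [← this, map_mul, Complex.conj_conj]
    linear_combination -z * hw
  exact ⟨w, _, _, Prod.ext (key p.1) (key p.2)⟩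

theorem isRealMultiple_of_mixForm_eq_zero {p : ℂ × ℂ} {u : ℂ} (hu : ‖u‖ = 1)
    (h : mixForm p u = 0) : IsRealMultiple p := by
  -- Vanishing means `z = -u z̄ = w² z̄` for each coefficient `z`, so `w̄ z = w z̄` is real.
  obtain ⟨w, hwu, hw⟩ := exists_sq_eq_of_norm_eq_one (u := -u) (by rwa [norm_neg])
  have key : ∀ z : ℂ, z + u * (starRingEnd ℂ) z = 0 →
      z = w * ((((starRingEnd ℂ) w * z).re : ℝ) : ℂ) := by
    intro z hz
    have hconj : (starRingEnd ℂ) ((starRingEnd ℂ) w * z) = (starRingEnd ℂ) w * z := by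
      rw [map_mul, Complex.conj_conj]
      linear_combination -(w * (starRingEnd ℂ) z) * hw - (starRingEnd ℂ) w * hz +
        (starRingEnd ℂ) w * (starRingEnd ℂ) z * hwu
    rw [Complex.conj_eq_iff_re.1 hconj]
    linear_combination -z * hw
  have h1 := congrArg Prod.fst h
  have h2 := congrArg Prod.snd h
  exact ⟨w, _, _, Prod.ext (key p.1 h1) (key p.2 h2)⟩

theorem measurable_tripleKernel_mixForm (p q r : ℂ × ℂ) :
    Measurable fun z : ℝ × ℝ => ENNReal.ofReal
      (tripleKernel (mixForm p (circleMap 0 1 z.2)) q r z.1) := by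
  have h : Continuous (circleMap 0 1) := continuous_circleMap 0 1
  have h1 : ∀ s, Continuous fun z : ℝ × ℝ => bracket (mixForm p (circleMap 0 1 z.2)) s := by
    intro s
    simp only [bracket_mixForm]
    fun_prop
  have h2 : Continuous fun z : ℝ × ℝ => slopeEval (mixForm p (circleMap 0 1 z.2)) z.1 := by
    simp only [slopeEval, mixForm]
    fun_prop
  have h3 : ∀ s, Continuous fun z : ℝ × ℝ => slopeEval s z.1 := fun s =>
    (continuous_slopeEval s).comp continuous_fst
  unfold tripleKernel
  have m1 : Measurable fun z : ℝ × ℝ => ‖bracket (mixForm p (circleMap 0 1 z.2)) q‖ *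
      ‖bracket (mixForm p (circleMap 0 1 z.2)) r‖ * ‖bracket q r‖ :=
    (((h1 q).norm.mul (h1 r).norm).mul continuous_const).measurable
  have m2 : Measurable fun z : ℝ × ℝ => ‖slopeEval (mixForm p (circleMap 0 1 z.2)) z.1‖ *
      ‖slopeEval q z.1‖ * ‖slopeEval r z.1‖ :=
    ((h2.norm.mul (h3 q).norm).mul (h3 r).norm).measurable
  exact ((m1.pow_const _).mul (m2.pow_const _)).ennreal_ofReal

theorem measurable_tripleKernel (p q r : ℂ × ℂ) :
    Measurable fun t : ℝ => ENNReal.ofReal (tripleKernel p q r t) := by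
  unfold tripleKernel
  have m2 : Measurable fun t : ℝ => ‖slopeEval p t‖ * ‖slopeEval q t‖ * ‖slopeEval r t‖ :=
    (((continuous_slopeEval p).norm.mul (continuous_slopeEval q).norm).mul
      (continuous_slopeEval r).norm).measurable
  exact ((m2.pow_const _).const_mul _).ennreal_ofReal

/-- The logarithm of `tripleKernel (mixForm p u) q r t`, up to zeros of its factors. -/
noncomputable def logMixKernel (p q r : ℂ × ℂ) (t : ℝ) (u : ℂ) : ℝ :=
  1 / 3 * (Real.log ‖bracket p q + u * bracket ((starRingEnd ℂ) p.1, (starRingEnd ℂ) p.2) q‖ +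
    Real.log ‖bracket p r + u * bracket ((starRingEnd ℂ) p.1, (starRingEnd ℂ) p.2) r‖ +
    Real.log ‖bracket q r‖) -
  2 / 3 * (Real.log ‖slopeEval p t + u * (starRingEnd ℂ) (slopeEval p t)‖ +
    Real.log ‖slopeEval q t‖ + Real.log ‖slopeEval r t‖)

variable {p q r : ℂ × ℂ} {t : ℝ}

theorem integrable_logMixKernel (p q r : ℂ × ℂ) (t : ℝ) :
    Integrable (fun θ => logMixKernel p q r t (circleMap 0 1 θ)) angleMeasure := by
  unfold logMixKernel
  have hi := integrable_log_norm_add_circleMap_mul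
  exact ((((hi _ _).add (hi _ _)).add (integrable_const _)).const_mul _).sub
    ((((hi _ _).add (integrable_const _)).add (integrable_const _)).const_mul _)

theorem integral_logMixKernel (p q r : ℂ × ℂ) (t : ℝ) :
    ∫ θ, logMixKernel p q r t (circleMap 0 1 θ) ∂angleMeasure =
      1 / 3 * (Real.log (max ‖bracket p q‖ ‖bracket ((starRingEnd ℂ) p.1, (starRingEnd ℂ) p.2) q‖) +
        Real.log (max ‖bracket p r‖ ‖bracket ((starRingEnd ℂ) p.1, (starRingEnd ℂ) p.2) r‖) +
        Real.log ‖bracket q r‖) -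
      2 / 3 * (Real.log ‖slopeEval p t‖ + Real.log ‖slopeEval q t‖ +
        Real.log ‖slopeEval r t‖) := by
  have hi := integrable_log_norm_add_circleMap_mul
  have key : ∀ {f g h : ℝ → ℝ} (a b c : ℝ), Integrable f angleMeasure →
      Integrable g angleMeasure → Integrable h angleMeasure →
      ∫ θ, (1 / 3 * (f θ + g θ + a) - 2 / 3 * (h θ + b + c)) ∂angleMeasure =
        1 / 3 * ((∫ θ, f θ ∂angleMeasure) + (∫ θ, g θ ∂angleMeasure) + a) -
          2 / 3 * ((∫ θ, h θ ∂angleMeasure) + b + c) := by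
    intro f g h a b c hf hg hh
    have h1 : Integrable (fun θ => f θ + g θ) angleMeasure := hf.add hg
    have h2 : Integrable (fun θ => h θ + b) angleMeasure := hh.add (integrable_const _)
    have h3 : Integrable (fun θ => f θ + g θ + a) angleMeasure := h1.add (integrable_const _)
    have h4 : Integrable (fun θ => h θ + b + c) angleMeasure := h2.add (integrable_const _)
    rw [integral_sub (h3.const_mul _) (h4.const_mul _), integral_const_mul, integral_const_mul,
      integral_add h1 (integrable_const _), integral_add h2 (integrable_const _),
      integral_add hf hg, integral_add hh (integrable_const _)]
    simp
  unfold logMixKernel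
  rw [key _ _ _ (hi _ _) (hi _ _) (hi _ _)]
  simp only [integral_log_norm_add_circleMap_mul]
  simp

theorem ae_tripleKernel_mixForm_eq (hpq : bracket p q ≠ 0) (hpr : bracket p r ≠ 0)
    (hqr : bracket q r ≠ 0) (hp : slopeEval p t ≠ 0) (hq : slopeEval q t ≠ 0)
    (hr : slopeEval r t ≠ 0) :
    ∀ᵐ θ ∂angleMeasure, tripleKernel (mixForm p (circleMap 0 1 θ)) q r t =
      Real.exp (logMixKernel p q r t (circleMap 0 1 θ)) := by
  filter_upwards [ae_add_circleMap_mul_ne_zero (Or.inl hpq), ae_add_circleMap_mul_ne_zero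
    (Or.inl hpr), ae_add_circleMap_mul_ne_zero (Or.inl hp)] with θ h1 h2 h3
  rw [← bracket_mixForm] at h1 h2
  rw [← slopeEval_mixForm] at h3
  rw [tripleKernel_eq_exp h1 h2 hqr h3 hq hr, logMixKernel, bracket_mixForm, bracket_mixForm,
    slopeEval_mixForm]

/-- The only loss is replacing `max (|[p, q]|, |[p̄, q]|)` by `|[p, q]|`, and likewise for `r`; the
terms involving `t` agree exactly. -/
theorem tripleKernel_le_exp_integral (hpq : bracket p q ≠ 0) (hpr : bracket p r ≠ 0)
    (hqr : bracket q r ≠ 0) (hp : slopeEval p t ≠ 0) (hq : slopeEval q t ≠ 0)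
    (hr : slopeEval r t ≠ 0) :
    tripleKernel p q r t ≤
      Real.exp (∫ θ, logMixKernel p q r t (circleMap 0 1 θ) ∂angleMeasure) := by
  rw [tripleKernel_eq_exp hpq hpr hqr hp hq hr, integral_logMixKernel, Real.exp_le_exp]
  have h1 := Real.log_le_log (norm_pos_iff.2 hpq)
    (le_max_left _ ‖bracket ((starRingEnd ℂ) p.1, (starRingEnd ℂ) p.2) q‖)
  have h2 := Real.log_le_log (norm_pos_iff.2 hpr)
    (le_max_left _ ‖bracket ((starRingEnd ℂ) p.1, (starRingEnd ℂ) p.2) r‖)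
  linarith

theorem tripleKernel_le_lintegral_mixForm (hpq : bracket p q ≠ 0) (hpr : bracket p r ≠ 0)
    (hqr : bracket q r ≠ 0) (hp : slopeEval p t ≠ 0) (hq : slopeEval q t ≠ 0)
    (hr : slopeEval r t ≠ 0) :
    ENNReal.ofReal (tripleKernel p q r t) ≤
      ∫⁻ θ, ENNReal.ofReal (tripleKernel (mixForm p (circleMap 0 1 θ)) q r t) ∂angleMeasure := by
  rw [lintegral_congr_ae ((ae_tripleKernel_mixForm_eq hpq hpr hqr hp hq hr).mono fun θ h =>
    congrArg ENNReal.ofReal h)]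
  exact (ENNReal.ofReal_le_ofReal (tripleKernel_le_exp_integral hpq hpr hqr hp hq hr)).trans
    (ofReal_exp_integral_le_lintegral (integrable_logMixKernel p q r t))

/-- Equality in Jensen makes the log of the mixed kernel constant in `u`. With denominators cleared,
this is an identity of continuous functions on the whole circle, including the `u` where the mixed
form vanishes at `(t, 1)`. -/
theorem isRealMultiple_of_lintegral_mixForm_le (hpq : bracket p q ≠ 0) (hpr : bracket p r ≠ 0)
    (hqr : bracket q r ≠ 0) (hp : slopeEval p t ≠ 0) (hq : slopeEval q t ≠ 0)
    (hr : slopeEval r t ≠ 0)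
    (h : ∫⁻ θ, ENNReal.ofReal (tripleKernel (mixForm p (circleMap 0 1 θ)) q r t) ∂angleMeasure ≤
      ENNReal.ofReal (tripleKernel p q r t)) : IsRealMultiple p := by
  rw [lintegral_congr_ae ((ae_tripleKernel_mixForm_eq hpq hpr hqr hp hq hr).mono fun θ h =>
    congrArg ENNReal.ofReal h)] at h
  have hconst := ae_eq_integral_of_lintegral_exp_eq (integrable_logMixKernel p q r t)
    (h.trans (ENNReal.ofReal_le_ofReal (tripleKernel_le_exp_integral hpq hpr hqr hp hq hr)))
  set m := ∫ θ, logMixKernel p q r t (circleMap 0 1 θ) ∂angleMeasure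
  -- Solving `logMixKernel = m` for the logs of the two mixed brackets gives `c` plus twice the log
  -- of the mixed value, that is, `φ = 0`.
  set c := 3 * m - Real.log ‖bracket q r‖ +
    2 * (Real.log ‖slopeEval q t‖ + Real.log ‖slopeEval r t‖) with hc
  let φ : ℂ → ℝ := fun u => ‖bracket (mixForm p u) q‖ * ‖bracket (mixForm p u) r‖ -
    Real.exp c * ‖slopeEval (mixForm p u) t‖ ^ 2
  have hφ : Continuous φ := by
    simp only [φ, bracket_mixForm, slopeEval_mixForm]
    fun_prop
  have hae : ∀ᵐ θ ∂angleMeasure, φ (circleMap 0 1 θ) = 0 := by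
    filter_upwards [hconst, ae_add_circleMap_mul_ne_zero (Or.inl hpq),
      ae_add_circleMap_mul_ne_zero (Or.inl hpr), ae_add_circleMap_mul_ne_zero (Or.inl hp)]
      with θ h0 h1 h2 h3
    rw [← norm_ne_zero_iff] at h1 h2 h3
    simp only [logMixKernel] at h0
    simp only [φ, bracket_mixForm, slopeEval_mixForm]
    rw [sub_eq_zero]
    refine Real.log_injOn_pos (Set.mem_Ioi.2 (by positivity)) (Set.mem_Ioi.2 (by positivity)) ?_
    rw [Real.log_mul h1 h2, Real.log_mul (Real.exp_pos _).ne' (by positivity), Real.log_exp,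
      Real.log_pow, hc]
    push_cast
    linear_combination 3 * h0
  -- The point of the circle at which the mixed form vanishes at `(t, 1)`.
  set u : ℂ := -slopeEval p t / (starRingEnd ℂ) (slopeEval p t) with hu
  have hconj : (starRingEnd ℂ) (slopeEval p t) ≠ 0 := (map_ne_zero _).2 hp
  have hu1 : ‖u‖ = 1 := by
    rw [hu, norm_div, norm_neg, RCLike.norm_conj, div_self (norm_ne_zero_iff.2 hp)]
  have hzero : slopeEval (mixForm p u) t = 0 := by
    rw [slopeEval_mixForm, hu, div_mul_cancel₀ _ hconj, add_neg_cancel]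
  have hφu : φ u = 0 := circle_eq_zero_of_ae hφ hae hu1
  simp only [φ, hzero, norm_zero] at hφu
  by_contra hnr
  -- A nonzero mixed form vanishing at `(t, 1)` and proportional to `q` or `r` would make that form
  -- vanish there too, which is excluded.
  have hmix : mixForm p u ≠ 0 := fun h0 => hnr (isRealMultiple_of_mixForm_eq_zero hu1 h0)
  have hprod : bracket (mixForm p u) q = 0 ∨ bracket (mixForm p u) r = 0 := by
    simpa using hφu
  rcases hprod with h1 | h1
  · exact hq (slopeEval_eq_zero_of_bracket hmix hzero h1)
  · exact hr (slopeEval_eq_zero_of_bracket hmix hzero h1)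

theorem tripleMass_le_lintegral_mixForm (hpq : bracket p q ≠ 0) (hpr : bracket p r ≠ 0)
    (hqr : bracket q r ≠ 0) :
    tripleMass p q r ≤ ∫⁻ θ, tripleMass (mixForm p (circleMap 0 1 θ)) q r ∂angleMeasure := by
  unfold tripleMass
  rw [← lintegral_lintegral_swap (measurable_tripleKernel_mixForm p q r).aemeasurable]
  refine lintegral_mono_ae ?_
  filter_upwards [ae_slopeEval_ne_zero (ne_zero_of_bracket_ne_zero hpq),
    ae_slopeEval_ne_zero (ne_zero_of_bracket_ne_zero hqr),
    ae_slopeEval_ne_zero (ne_zero_of_bracket_ne_zero (bracket_ne_zero_comm hqr))] with t h1 h2 h3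
  exact tripleKernel_le_lintegral_mixForm hpq hpr hqr h1 h2 h3

/-- The pointwise bound and the finite total mass force equality for almost every `t`; a single such
`t` suffices. -/
theorem isRealMultiple_of_lintegral_tripleMass_le (hpq : bracket p q ≠ 0) (hpr : bracket p r ≠ 0)
    (hqr : bracket q r ≠ 0) (hfin : tripleMass p q r ≠ ⊤)
    (h : ∫⁻ θ, tripleMass (mixForm p (circleMap 0 1 θ)) q r ∂angleMeasure ≤ tripleMass p q r) :
    IsRealMultiple p := by
  have hmeas := measurable_tripleKernel_mixForm p q r
  unfold tripleMass at h hfin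
  rw [← lintegral_lintegral_swap hmeas.aemeasurable] at h
  have hne := ae_slopeEval_ne_zero (ne_zero_of_bracket_ne_zero hpq)
  have hne2 := ae_slopeEval_ne_zero (ne_zero_of_bracket_ne_zero hqr)
  have hne3 := ae_slopeEval_ne_zero (ne_zero_of_bracket_ne_zero (bracket_ne_zero_comm hqr))
  have hle : ∀ᵐ t : ℝ, ENNReal.ofReal (tripleKernel p q r t) ≤
      ∫⁻ θ, ENNReal.ofReal (tripleKernel (mixForm p (circleMap 0 1 θ)) q r t) ∂angleMeasure := by
    filter_upwards [hne, hne2, hne3] with t h1 h2 h3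
    exact tripleKernel_le_lintegral_mixForm hpq hpr hqr h1 h2 h3
  have hm2 : Measurable fun t => ∫⁻ θ, ENNReal.ofReal
      (tripleKernel (mixForm p (circleMap 0 1 θ)) q r t) ∂angleMeasure :=
    hmeas.lintegral_prod_right'
  have heq := ae_eq_of_ae_le_of_lintegral_le hle hfin hm2.aemeasurable h
  obtain ⟨t, ⟨⟨h1, h2⟩, h3⟩, h4⟩ := (((hne.and hne2).and hne3).and heq).exists
  exact isRealMultiple_of_lintegral_mixForm_le hpq hpr hqr h1 h2 h3 h4.ge

end Mixing

/-! ### The sharp bound for three linear factors -/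

section CubicBound

variable {p q r : ℂ × ℂ}

/-- The mass is at most a mean of masses whose first factor is a multiple of a real form. -/
theorem tripleMass_le_of_forall_isRealMultiple {M : ENNReal}
    (h : ∀ p, IsRealMultiple p → tripleMass p q r ≤ M) (p : ℂ × ℂ) : tripleMass p q r ≤ M := by
  by_cases hb : bracket p q = 0 ∨ bracket p r = 0 ∨ bracket q r = 0
  · rw [tripleMass_eq_zero hb]; exact zero_le
  push Not at hb
  refine (tripleMass_le_lintegral_mixForm hb.1 hb.2.1 hb.2.2).trans ?_
  refine (lintegral_mono fun θ => h _ (isRealMultiple_mixForm p (by simp))).trans ?_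
  simp

theorem tripleMass_le (p q r : ℂ × ℂ) :
    tripleMass p q r ≤ ENNReal.ofReal (3 * ProbabilityTheory.beta (1 / 3) (1 / 3)) := by
  refine tripleMass_le_of_forall_isRealMultiple (fun p hp => ?_) p
  -- By symmetry each factor in turn takes the first slot, while those already reduced stay
  -- multiples of real forms.
  rw [tripleMass_comm₁₂]
  refine tripleMass_le_of_forall_isRealMultiple (fun q hq => ?_) q
  rw [tripleMass_comm₁₂, tripleMass_comm₂₃, tripleMass_comm₁₂]
  refine tripleMass_le_of_forall_isRealMultiple (fun r hr => ?_) r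
  by_cases hb : bracket r p = 0 ∨ bracket r q = 0 ∨ bracket p q = 0
  · rw [tripleMass_eq_zero hb]; exact zero_le
  push Not at hb
  exact (tripleMass_of_isRealMultiple hr hp hq hb.1 hb.2.1 hb.2.2).le

theorem isRealMultiple_of_tripleMass_eq (hpq : bracket p q ≠ 0) (hpr : bracket p r ≠ 0)
    (hqr : bracket q r ≠ 0)
    (h : tripleMass p q r = ENNReal.ofReal (3 * ProbabilityTheory.beta (1 / 3) (1 / 3))) :
    IsRealMultiple p := by
  refine isRealMultiple_of_lintegral_tripleMass_le hpq hpr hqr (h ▸ ENNReal.ofReal_ne_top) ?_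
  rw [h]
  exact (lintegral_mono fun θ => tripleMass_le _ q r).trans (by simp)

end CubicBound

/-! ### Sums over triples of distinct indices -/

section DistinctTriples

/-- The ordered triples of distinct indices. -/
def distinctTriples (n : ℕ) : Finset (Fin n × Fin n × Fin n) :=
  {T | T.1 ≠ T.2.1 ∧ T.1 ≠ T.2.2 ∧ T.2.1 ≠ T.2.2}

theorem mem_distinctTriples {n : ℕ} {T : Fin n × Fin n × Fin n} :
    T ∈ distinctTriples n ↔ T.1 ≠ T.2.1 ∧ T.1 ≠ T.2.2 ∧ T.2.1 ≠ T.2.2 := by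
  simp [distinctTriples]

/-- Inclusion-exclusion: the total diagonal is subtracted three times, so it is added back twice. -/
theorem sum_distinctTriples {n : ℕ} (h : Fin n → Fin n → Fin n → ℝ) :
    ∑ T ∈ distinctTriples n, h T.1 T.2.1 T.2.2 =
      ∑ i, ∑ j, ∑ k, h i j k - ∑ i, ∑ k, h i i k - ∑ i, ∑ j, h i j i - ∑ i, ∑ j, h i j j +
        2 * ∑ i, h i i i := by
  have key : ∀ i j k : Fin n, (if i ≠ j ∧ i ≠ k ∧ j ≠ k then h i j k else 0) =
      h i j k - (if i = j then h i i k else 0) - (if i = k then h i j i else 0) -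
        (if j = k then h i j j else 0) + 2 * (if i = j then if i = k then h i i i else 0 else 0) := by
    intro i j k
    by_cases hij : i = j
    · subst hij
      by_cases hik : i = k
      · subst hik; simp; ring
      · simp [hik]
    · by_cases hik : i = k
      · subst hik; simp [hij, Ne.symm hij]
      · by_cases hjk : j = k
        · subst hjk; simp [hij]
        · simp [hij, hik, hjk]
  rw [distinctTriples, Finset.sum_filter, Fintype.sum_prod_type]
  simp_rw [Fintype.sum_prod_type, key, Finset.sum_add_distrib, Finset.sum_sub_distrib,
    ← Finset.mul_sum]
  have h1 : ∀ i : Fin n, (∑ j, ∑ k, if i = j then h i i k else 0) = ∑ k, h i i k := by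
    intro i
    rw [Finset.sum_comm]
    simp
  have h2 : ∀ i : Fin n, (∑ j, ∑ k, if i = j then if i = k then h i i i else 0 else 0) =
      h i i i := by
    intro i
    rw [Finset.sum_comm]
    simp
  simp only [h1, h2]
  simp

theorem card_distinctTriples (n : ℕ) :
    ((distinctTriples n).card : ℝ) = n * (n - 1) * (n - 2) := by
  have := sum_distinctTriples (n := n) fun _ _ _ => 1
  simp only [Finset.sum_const, Finset.card_univ, Fintype.card_fin, nsmul_eq_mul, mul_one] at this
  rw [this]
  ring

/-- Each ordered pair of distinct indices fills each of the three pairs of slots `n - 2` times, and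
each index fills each slot `(n - 1)(n - 2)` times. Dividing by `n(n - 1)(n - 2)` gives the exponents
`1/(n(n - 1))` and `-2/n`. -/
theorem sum_distinctTriples_log {n : ℕ} {b : Fin n → Fin n → ℝ} (hb : ∀ i, b i i = 0)
    (l : Fin n → ℝ) :
    ∑ T ∈ distinctTriples n, (1 / 3 * (b T.1 T.2.1 + b T.1 T.2.2 + b T.2.1 T.2.2) -
        2 / 3 * (l T.1 + l T.2.1 + l T.2.2)) =
      (n - 2) * ∑ i, ∑ j, b i j - 2 * (n - 1) * (n - 2) * ∑ i, l i := by
  rw [sum_distinctTriples fun i j k => 1 / 3 * (b i j + b i k + b j k) - 2 / 3 * (l i + l j + l k)]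
  have hcomm : ∑ i, ∑ j, b j i = ∑ i, ∑ j, b i j := Finset.sum_comm
  simp only [hb, Finset.sum_add_distrib, Finset.sum_sub_distrib, ← Finset.mul_sum,
    Finset.sum_const, Finset.card_univ, Fintype.card_fin, nsmul_eq_mul, hcomm]
  ring

end DistinctTriples

/-! ### From degree `n` to cubics, and the extremal case -/

section NormalizedArea

variable {n : ℕ} {α β : Fin n → ℂ} {F : MvPolynomial (Fin 2) ℂ}

theorem bracket_ne_zero_of_factorDisc_ne_zero (hD : factorDisc α β ≠ 0) {i j : Fin n}
    (hij : i ≠ j) : bracket (α i, β i) (α j, β j) ≠ 0 := by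
  rw [factorDisc_eq_offDiag] at hD
  have h1 := (Finset.prod_ne_zero_iff.1 (right_ne_zero_of_mul hD)) i (Finset.mem_univ i)
  have h2 := (Finset.prod_ne_zero_iff.1 h1) j (by simpa using hij.symm)
  intro h
  apply h2
  simp only [bracket] at h
  linear_combination -h

/-- Each squared bracket is split over its two orderings. The diagonal terms can be included because
`Real.log 0 = 0`. -/
theorem log_norm_factorDisc (hD : factorDisc α β ≠ 0) :
    Real.log ‖factorDisc α β‖ = ∑ i, ∑ j, Real.log ‖bracket (α i, β i) (α j, β j)‖ := by
  have hne : ∀ i : Fin n, ∀ j ∈ ({i}ᶜ : Finset (Fin n)), α j * β i - α i * β j ≠ 0 := by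
    intro i j hj h
    have hij : i ≠ j := by simpa [eq_comm] using hj
    apply bracket_ne_zero_of_factorDisc_ne_zero hD hij
    simp only [bracket]
    linear_combination -h
  rw [factorDisc_eq_offDiag, norm_mul]
  have h1 : ‖∏ i : Fin n, ∏ _j ∈ Finset.Ioi i, (-1 : ℂ)‖ = 1 := by simp [norm_prod]
  rw [h1, one_mul, norm_prod, Real.log_prod fun i _ =>
    norm_ne_zero_iff.2 (Finset.prod_ne_zero_iff.2 (hne i))]
  refine Finset.sum_congr rfl fun i _ => ?_
  rw [norm_prod, Real.log_prod fun j hj => norm_ne_zero_iff.2 (hne i j hj),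
    ← Finset.sum_compl_add_sum {i}, Finset.sum_singleton]
  have h2 : bracket (α i, β i) (α i, β i) = 0 := by simp [bracket]
  rw [h2, norm_zero, Real.log_zero, add_zero]
  refine Finset.sum_congr rfl fun j _ => ?_
  rw [← norm_neg]
  congr 2
  simp only [bracket]
  ring

/-- `|D|^{1/(n(n-1))} |F(t, 1)|^{-2/n}` for a product `F` of `n` linear forms. -/
noncomputable def areaKernel (α β : Fin n → ℂ) (t : ℝ) : ℝ :=
  ‖factorDisc α β‖ ^ (1 / ((n : ℝ) * ((n : ℝ) - 1))) *
    (∏ i, ‖slopeEval (α i, β i) t‖) ^ (-2 / (n : ℝ))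

theorem ae_forall_slopeEval_ne_zero (hn : 2 ≤ n) (hD : factorDisc α β ≠ 0) :
    ∀ᵐ t : ℝ, ∀ i, slopeEval (α i, β i) t ≠ 0 := by
  rw [ae_all_iff]
  intro i
  have : Nontrivial (Fin n) := Fin.nontrivial_iff_two_le.2 hn
  obtain ⟨j, hj⟩ := exists_ne i
  exact ae_slopeEval_ne_zero
    (ne_zero_of_bracket_ne_zero (bracket_ne_zero_of_factorDisc_ne_zero hD hj.symm))

theorem ofReal_mul_formArea_eq_lintegral (hn : 2 ≤ n) (hF : IsLinearFactorization F α β)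
    (hD : factorDisc α β ≠ 0) :
    ENNReal.ofReal (‖formDisc n F‖ ^ (1 / ((n : ℝ) * ((n : ℝ) - 1)))) * formArea F =
      ∫⁻ t, ENNReal.ofReal (areaKernel α β t) := by
  have hev : ∀ x y : ℂ, eval ![x, y] F = ∏ i, (α i * x - β i * y) := by
    intro x y
    rw [hF, map_prod]
    exact Finset.prod_congr rfl fun i _ => eval_linForm _ _ _ _
  rw [formDisc_eq hn hF, formArea, volume_le_one_eq_lintegral (n := n) (by omega)
    (f := fun p : ℝ × ℝ => ‖eval ![(p.1 : ℂ), (p.2 : ℂ)] F‖),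
    ← lintegral_const_mul' _ _ ENNReal.ofReal_ne_top]
  · refine lintegral_congr fun t => ?_
    rw [← ENNReal.ofReal_mul (by positivity), areaKernel]
    simp only [hev, slopeEval, norm_prod, Complex.ofReal_one, mul_one]
  · simp only [hev]
    fun_prop
  · intro t y
    simp only [hev]
    rw [← Real.norm_eq_abs, ← Complex.norm_real, ← norm_pow, ← norm_mul]
    congr 1
    have : (y : ℂ) ^ n = ∏ _i : Fin n, (y : ℂ) := by simp
    rw [this, ← Finset.prod_mul_distrib]
    refine Finset.prod_congr rfl fun i _ => ?_
    push_cast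
    ring
  · filter_upwards [ae_forall_slopeEval_ne_zero hn hD] with t ht
    rw [norm_pos_iff, hev, Finset.prod_ne_zero_iff]
    intro i _
    simpa [slopeEval] using ht i

/-- The logarithm of the triple kernel of the factors with indices `T`. -/
noncomputable def tripleExponent (α β : Fin n → ℂ) (t : ℝ) (T : Fin n × Fin n × Fin n) : ℝ :=
  1 / 3 * (Real.log ‖bracket (α T.1, β T.1) (α T.2.1, β T.2.1)‖ +
    Real.log ‖bracket (α T.1, β T.1) (α T.2.2, β T.2.2)‖ +
    Real.log ‖bracket (α T.2.1, β T.2.1) (α T.2.2, β T.2.2)‖) -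
  2 / 3 * (Real.log ‖slopeEval (α T.1, β T.1) t‖ + Real.log ‖slopeEval (α T.2.1, β T.2.1) t‖ +
    Real.log ‖slopeEval (α T.2.2, β T.2.2) t‖)

theorem card_distinctTriples_pos (hn : 3 ≤ n) : (0 : ℝ) < (distinctTriples n).card := by
  have : (3 : ℝ) ≤ n := by exact_mod_cast hn
  rw [card_distinctTriples]
  exact mul_pos (mul_pos (by linarith) (by linarith)) (by linarith)

/-- The kernel in degree `n` is the geometric mean of the triple kernels, which prepares AM-GM. -/
theorem areaKernel_eq_exp (hn : 3 ≤ n) (hD : factorDisc α β ≠ 0) {t : ℝ}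
    (ht : ∀ i, slopeEval (α i, β i) t ≠ 0) :
    areaKernel α β t = Real.exp (∑ T ∈ distinctTriples n,
      ((distinctTriples n).card : ℝ)⁻¹ • tripleExponent α β t T) := by
  have hn' : (3 : ℝ) ≤ n := by exact_mod_cast hn
  have hprod : 0 < ∏ i, ‖slopeEval (α i, β i) t‖ :=
    Finset.prod_pos fun i _ => norm_pos_iff.2 (ht i)
  rw [areaKernel, Real.rpow_def_of_pos (norm_pos_iff.2 hD), Real.rpow_def_of_pos hprod,
    ← Real.exp_add, log_norm_factorDisc hD,
    Real.log_prod fun i _ => norm_ne_zero_iff.2 (ht i)]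
  congr 1
  simp only [smul_eq_mul]
  rw [← Finset.mul_sum]
  simp only [tripleExponent]
  rw [sum_distinctTriples_log (b := fun i j => Real.log ‖bracket (α i, β i) (α j, β j)‖)
    (fun i => by simp [bracket])
    (fun i => Real.log ‖slopeEval (α i, β i) t‖), card_distinctTriples]
  have h0 : (n : ℝ) ≠ 0 := by linarith
  have h1 : (n : ℝ) - 1 ≠ 0 := by linarith
  have h2 : (n : ℝ) - 2 ≠ 0 := by linarith
  field_simp
  ring

theorem tripleKernel_eq_exp_tripleExponent (hD : factorDisc α β ≠ 0) {t : ℝ}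
    (ht : ∀ i, slopeEval (α i, β i) t ≠ 0) {T : Fin n × Fin n × Fin n}
    (hT : T ∈ distinctTriples n) :
    tripleKernel (α T.1, β T.1) (α T.2.1, β T.2.1) (α T.2.2, β T.2.2) t =
      Real.exp (tripleExponent α β t T) := by
  rw [mem_distinctTriples] at hT
  exact tripleKernel_eq_exp (bracket_ne_zero_of_factorDisc_ne_zero hD hT.1)
    (bracket_ne_zero_of_factorDisc_ne_zero hD hT.2.1)
    (bracket_ne_zero_of_factorDisc_ne_zero hD hT.2.2) (ht _) (ht _) (ht _)

/-- The average of the triple kernels. -/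
noncomputable def meanKernel (α β : Fin n → ℂ) (t : ℝ) : ENNReal :=
  ∑ T ∈ distinctTriples n, ENNReal.ofReal ((distinctTriples n).card : ℝ)⁻¹ * ENNReal.ofReal
    (tripleKernel (α T.1, β T.1) (α T.2.1, β T.2.1) (α T.2.2, β T.2.2) t)

theorem meanKernel_eq (hD : factorDisc α β ≠ 0) {t : ℝ} (ht : ∀ i, slopeEval (α i, β i) t ≠ 0) :
    meanKernel α β t = ENNReal.ofReal (∑ T ∈ distinctTriples n,
      ((distinctTriples n).card : ℝ)⁻¹ • Real.exp (tripleExponent α β t T)) := by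
  rw [meanKernel, ENNReal.ofReal_sum_of_nonneg fun T _ => by positivity]
  refine Finset.sum_congr rfl fun T hT => ?_
  rw [tripleKernel_eq_exp_tripleExponent hD ht hT, smul_eq_mul, ENNReal.ofReal_mul (by positivity)]

theorem sum_inv_card_distinctTriples (hn : 3 ≤ n) :
    ∑ _T ∈ distinctTriples n, ((distinctTriples n).card : ℝ)⁻¹ = 1 := by
  rw [Finset.sum_const, nsmul_eq_mul, mul_inv_cancel₀ (card_distinctTriples_pos hn).ne']

theorem areaKernel_le_meanKernel (hn : 3 ≤ n) (hD : factorDisc α β ≠ 0) {t : ℝ}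
    (ht : ∀ i, slopeEval (α i, β i) t ≠ 0) :
    ENNReal.ofReal (areaKernel α β t) ≤ meanKernel α β t := by
  rw [meanKernel_eq hD ht, areaKernel_eq_exp hn hD ht]
  refine ENNReal.ofReal_le_ofReal ?_
  exact convexOn_exp.map_sum_le (fun T _ => by positivity) (sum_inv_card_distinctTriples hn)
    (fun T _ => Set.mem_univ _)

theorem tripleExponent_eq_of_meanKernel_le (hn : 3 ≤ n) (hD : factorDisc α β ≠ 0) {t : ℝ}
    (ht : ∀ i, slopeEval (α i, β i) t ≠ 0)
    (h : meanKernel α β t ≤ ENNReal.ofReal (areaKernel α β t))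
    {T T' : Fin n × Fin n × Fin n} (hT : T ∈ distinctTriples n) (hT' : T' ∈ distinctTriples n) :
    tripleExponent α β t T = tripleExponent α β t T' := by
  rw [meanKernel_eq hD ht, areaKernel_eq_exp hn hD ht,
    ENNReal.ofReal_le_ofReal_iff (Real.exp_pos _).le] at h
  have hc := card_distinctTriples_pos hn
  exact strictConvexOn_exp.eq_of_le_map_sum (fun T _ => inv_pos.2 hc)
    (sum_inv_card_distinctTriples hn) (fun T _ => Set.mem_univ _) h hT hT'

theorem measurable_meanKernel (α β : Fin n → ℂ) : Measurable (meanKernel α β) := by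
  unfold meanKernel
  exact Finset.measurable_fun_sum _ fun T _ => (measurable_tripleKernel _ _ _).const_mul _

theorem lintegral_meanKernel (α β : Fin n → ℂ) :
    ∫⁻ t, meanKernel α β t = ∑ T ∈ distinctTriples n,
      ENNReal.ofReal ((distinctTriples n).card : ℝ)⁻¹ *
        tripleMass (α T.1, β T.1) (α T.2.1, β T.2.1) (α T.2.2, β T.2.2) := by
  unfold meanKernel
  rw [lintegral_finsetSum _ fun T _ => (measurable_tripleKernel _ _ _).const_mul _]
  exact Finset.sum_congr rfl fun T _ => lintegral_const_mul' _ _ ENNReal.ofReal_ne_top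

theorem sum_ofReal_inv_card_mul (hn : 3 ≤ n) (M : ENNReal) :
    ∑ _T ∈ distinctTriples n, ENNReal.ofReal ((distinctTriples n).card : ℝ)⁻¹ * M = M := by
  rw [← Finset.sum_mul, ← ENNReal.ofReal_sum_of_nonneg fun _ _ => by positivity,
    sum_inv_card_distinctTriples hn, ENNReal.ofReal_one, one_mul]

theorem lintegral_meanKernel_le (hn : 3 ≤ n) (α β : Fin n → ℂ) :
    ∫⁻ t, meanKernel α β t ≤ ENNReal.ofReal (3 * ProbabilityTheory.beta (1 / 3) (1 / 3)) := by
  rw [lintegral_meanKernel, ← sum_ofReal_inv_card_mul hn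
    (ENNReal.ofReal (3 * ProbabilityTheory.beta (1 / 3) (1 / 3)))]
  exact Finset.sum_le_sum fun T _ => mul_le_mul_right (tripleMass_le _ _ _) _

theorem lintegral_areaKernel_le_meanKernel (hn : 3 ≤ n) (hD : factorDisc α β ≠ 0) :
    ∫⁻ t, ENNReal.ofReal (areaKernel α β t) ≤ ∫⁻ t, meanKernel α β t := by
  refine lintegral_mono_ae ?_
  filter_upwards [ae_forall_slopeEval_ne_zero (by omega) hD] with t ht
  exact areaKernel_le_meanKernel hn hD ht

/-- Every term of the average is at most the bound and has positive weight, so one smaller term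
would pull the average strictly below it. -/
theorem tripleMass_eq_of_le_lintegral_meanKernel (hn : 3 ≤ n)
    (h : ENNReal.ofReal (3 * ProbabilityTheory.beta (1 / 3) (1 / 3)) ≤ ∫⁻ t, meanKernel α β t)
    {T : Fin n × Fin n × Fin n} (hT : T ∈ distinctTriples n) :
    tripleMass (α T.1, β T.1) (α T.2.1, β T.2.1) (α T.2.2, β T.2.2) =
      ENNReal.ofReal (3 * ProbabilityTheory.beta (1 / 3) (1 / 3)) := by
  refine le_antisymm (tripleMass_le _ _ _) ?_
  by_contra! hlt
  have hc := card_distinctTriples_pos hn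
  refine h.not_gt ?_
  rw [lintegral_meanKernel, ← sum_ofReal_inv_card_mul hn
    (ENNReal.ofReal (3 * ProbabilityTheory.beta (1 / 3) (1 / 3))),
    ← Finset.add_sum_erase _ _ hT, ← Finset.add_sum_erase _ (fun _ => _ * ENNReal.ofReal _) hT]
  refine ENNReal.add_lt_add_of_lt_of_le ?_ ?_ ?_
  · refine ne_top_of_le_ne_top (ENNReal.sum_ne_top.2 fun T _ => ?_)
      (Finset.sum_le_sum fun T _ => mul_le_mul_right (tripleMass_le _ _ _) _)
    exact ENNReal.mul_ne_top ENNReal.ofReal_ne_top ENNReal.ofReal_ne_top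
  · exact ENNReal.mul_lt_mul_right (ENNReal.ofReal_pos.2 (inv_pos.2 hc)).ne'
      ENNReal.ofReal_ne_top hlt
  · exact Finset.sum_le_sum fun T _ => mul_le_mul_right (tripleMass_le _ _ _) _

/-- In the extremal case all linear factors are complex multiples of real forms. -/
theorem isRealMultiple_of_le_lintegral_areaKernel (hn : 3 ≤ n) (hD : factorDisc α β ≠ 0)
    (h : ENNReal.ofReal (3 * ProbabilityTheory.beta (1 / 3) (1 / 3)) ≤
      ∫⁻ t, ENNReal.ofReal (areaKernel α β t)) (i : Fin n) : IsRealMultiple (α i, β i) := by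
  have : Nontrivial (Fin n) := Fin.nontrivial_iff_two_le.2 (by omega)
  obtain ⟨j, hj⟩ := exists_ne i
  have hcard : ({i, j} : Finset (Fin n)).card < (Finset.univ : Finset (Fin n)).card := by
    rw [Finset.card_univ, Fintype.card_fin]
    exact Finset.card_le_two.trans_lt hn
  obtain ⟨k, -, hk⟩ := Finset.exists_mem_notMem_of_card_lt_card hcard
  have hji : i ≠ j := hj.symm
  have hk' : k ≠ i ∧ k ≠ j := by simpa using hk
  have hT : (i, j, k) ∈ distinctTriples n := mem_distinctTriples.2 ⟨hji, hk'.1.symm, hk'.2.symm⟩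
  have hmass := tripleMass_eq_of_le_lintegral_meanKernel hn
    (h.trans (lintegral_areaKernel_le_meanKernel hn hD)) hT
  exact isRealMultiple_of_tripleMass_eq (bracket_ne_zero_of_factorDisc_ne_zero hD hji)
    (bracket_ne_zero_of_factorDisc_ne_zero hD hk'.1.symm)
    (bracket_ne_zero_of_factorDisc_ne_zero hD hk'.2.symm) hmass

/-- A nonzero multiple of a real form vanishes at some `(t, 1)` unless it is a multiple of `Y`. -/
theorem IsRealMultiple.exists_slopeEval_eq_zero {p : ℂ × ℂ} (hp : IsRealMultiple p)
    (h : p.1 ≠ 0) : ∃ t : ℝ, slopeEval p t = 0 := by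
  obtain ⟨c, a, b, rfl⟩ := hp
  have ha : (a : ℂ) ≠ 0 := right_ne_zero_of_mul h
  refine ⟨b / a, ?_⟩
  simp only [slopeEval]
  push_cast
  field_simp
  ring

/-- The slope functions of non-proportional real forms are not proportional. -/
theorem not_ae_log_norm_slopeEval_sub_eq_const {p q : ℂ × ℂ} (hp : IsRealMultiple p)
    (hq : IsRealMultiple q) (hpq : bracket p q ≠ 0) (c : ℝ) :
    ¬ ∀ᵐ t : ℝ, Real.log ‖slopeEval p t‖ - Real.log ‖slopeEval q t‖ = c := by
  intro h
  have hp0 := ne_zero_of_bracket_ne_zero hpq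
  have hq0 := ne_zero_of_bracket_ne_zero (bracket_ne_zero_comm hpq)
  have hcont : ∀ s, Continuous fun t => ‖slopeEval s t‖ := fun s => (continuous_slopeEval s).norm
  have hae : (fun t => ‖slopeEval p t‖) =ᵐ[volume] fun t => Real.exp c * ‖slopeEval q t‖ := by
    filter_upwards [h, ae_slopeEval_ne_zero hp0, ae_slopeEval_ne_zero hq0] with t ht h1 h2
    rw [← ht, Real.exp_sub, Real.exp_log (norm_pos_iff.2 h1), Real.exp_log (norm_pos_iff.2 h2),
      div_mul_cancel₀ _ (norm_ne_zero_iff.2 h2)]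
  -- Both sides are continuous, so the relation holds at every `t`, in particular at zeros of the
  -- forms.
  have heq : ∀ t, ‖slopeEval p t‖ = Real.exp c * ‖slopeEval q t‖ := congrFun ((hcont p).ae_eq_iff_eq volume (continuous_const.mul (hcont q)) |>.1 hae)
  -- A multiple of `Y` has no zero of the form `(t, 1)`, but by non-proportionality at most one of
  -- the two forms is such a multiple.
  by_cases h1 : p.1 = 0
  · have h2 : q.1 ≠ 0 := fun h2 => hpq (by simp [bracket, h1, h2])
    obtain ⟨t, ht⟩ := hq.exists_slopeEval_eq_zero h2
    have := heq t
    rw [ht, norm_zero, mul_zero, norm_eq_zero] at this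
    exact hpq (bracket_eq_zero_of_slopeEval this ht)
  · obtain ⟨t, ht⟩ := hp.exists_slopeEval_eq_zero h1
    have := heq t
    rw [ht, norm_zero, eq_comm, mul_eq_zero, norm_eq_zero] at this
    exact hpq (bracket_eq_zero_of_slopeEval ht (this.resolve_left (Real.exp_pos c).ne'))

/-- Only cubic forms are extremal. -/
theorem eq_three_of_le_lintegral_areaKernel (hn : 3 ≤ n) (hD : factorDisc α β ≠ 0)
    (h : ENNReal.ofReal (3 * ProbabilityTheory.beta (1 / 3) (1 / 3)) ≤
      ∫⁻ t, ENNReal.ofReal (areaKernel α β t)) : n = 3 := by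
  by_contra hne
  have hreal := isRealMultiple_of_le_lintegral_areaKernel hn hD h
  have hmean := lintegral_meanKernel_le hn α β
  have hne0 := ae_forall_slopeEval_ne_zero (by omega) hD
  have heq := ae_eq_of_ae_le_of_lintegral_le
    (hne0.mono fun t ht => areaKernel_le_meanKernel hn hD ht)
    (ne_top_of_le_ne_top ENNReal.ofReal_ne_top
      ((lintegral_areaKernel_le_meanKernel hn hD).trans hmean))
    (measurable_meanKernel α β).aemeasurable (hmean.trans h)
  let i : Fin 4 → Fin n := Fin.castLE (by omega)
  have hi : ∀ {a b : Fin 4}, a ≠ b → i a ≠ i b := fun hab =>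
    (Fin.castLE_injective _).ne hab
  have hT : (i 0, i 1, i 2) ∈ distinctTriples n :=
    mem_distinctTriples.2 ⟨hi (by decide), hi (by decide), hi (by decide)⟩
  have hT' : (i 0, i 1, i 3) ∈ distinctTriples n :=
    mem_distinctTriples.2 ⟨hi (by decide), hi (by decide), hi (by decide)⟩
  -- The exponents of two triples sharing their first two indices agree. The common terms cancel,
  -- and solving for the difference of the remaining two logs gives this constant.
  refine not_ae_log_norm_slopeEval_sub_eq_const (hreal (i 2)) (hreal (i 3))
    (bracket_ne_zero_of_factorDisc_ne_zero hD (hi (by decide)))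
    (1 / 2 * (Real.log ‖bracket (α (i 0), β (i 0)) (α (i 2), β (i 2))‖ +
      Real.log ‖bracket (α (i 1), β (i 1)) (α (i 2), β (i 2))‖ -
      Real.log ‖bracket (α (i 0), β (i 0)) (α (i 3), β (i 3))‖ -
      Real.log ‖bracket (α (i 1), β (i 1)) (α (i 3), β (i 3))‖)) ?_
  filter_upwards [hne0, heq] with t ht hteq
  have := tripleExponent_eq_of_meanKernel_le hn hD ht hteq.ge hT hT'
  simp only [tripleExponent] at this
  linarith

end NormalizedArea

/-! ### Extremal cubics and equivalence to `XY(X - Y)` -/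

section Cubic

variable {α β : Fin 3 → ℂ} {F : MvPolynomial (Fin 2) ℂ}

theorem eval_formAct (F : MvPolynomial (Fin 2) ℂ) (T : GL (Fin 2) ℝ) (x y : ℂ) :
    eval ![x, y] (formAct F T) = eval ![(T.val 0 0 : ℂ) * x + (T.val 0 1 : ℂ) * y,
      (T.val 1 0 : ℂ) * x + (T.val 1 1 : ℂ) * y] F := by
  rw [formAct, ← coe_aeval_eq_eval, ← coe_aeval_eq_eval]
  change aeval _ (bind₁ _ F) = aeval _ F
  rw [aeval_bind₁]
  congr 2
  ext i
  fin_cases i <;> simp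

theorem ext_eval {F G : MvPolynomial (Fin 2) ℂ}
    (h : ∀ x y : ℂ, eval ![x, y] F = eval ![x, y] G) : F = G := by
  refine MvPolynomial.funext fun v => ?_
  have hv : v = ![v 0, v 1] := by ext i; fin_cases i <;> rfl
  rw [hv]
  exact h _ _

/-- The discriminant is the square of the product of the three brackets, and `2 · 1/6 = 1/3`. -/
theorem areaKernel_three (α β : Fin 3 → ℂ) (t : ℝ) :
    areaKernel α β t = tripleKernel (α 0, β 0) (α 1, β 1) (α 2, β 2) t := by
  have h1 : ‖factorDisc α β‖ = (‖bracket (α 0, β 0) (α 1, β 1)‖ *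
      ‖bracket (α 0, β 0) (α 2, β 2)‖ * ‖bracket (α 1, β 1) (α 2, β 2)‖) ^ 2 := by
    have e0 : Finset.Ioi (0 : Fin 3) = {1, 2} := by decide
    have e1 : Finset.Ioi (1 : Fin 3) = {2} := by decide
    have e2 : Finset.Ioi (2 : Fin 3) = ∅ := by decide
    rw [factorDisc, Fin.prod_univ_three, e0, e1, e2, Finset.prod_pair (by decide),
      Finset.prod_singleton, Finset.prod_empty]
    simp only [bracket, norm_mul, norm_pow, norm_one]
    ring
  rw [areaKernel, tripleKernel, h1, ← Real.rpow_natCast, ← Real.rpow_mul (by positivity),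
    Fin.prod_univ_three]
  norm_num

/-- A form whose factors are complex multiples of real forms is, up to a scalar, equivalent to
`XY(X - Y)`. -/
theorem exists_formEquiv_of_isRealMultiple (hF : IsLinearFactorization F α β)
    (hD : factorDisc α β ≠ 0) (hreal : ∀ i, IsRealMultiple (α i, β i)) :
    ∃ c : ℂ, c ≠ 0 ∧ FormEquiv (C c * F) (X 0 * X 1 * (X 0 - X 1)) := by
  choose c a b hab using hreal
  have hα : ∀ i, α i = c i * a i := fun i => congrArg Prod.fst (hab i)
  have hβ : ∀ i, β i = c i * b i := fun i => congrArg Prod.snd (hab i)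
  have hne : ∀ {i j}, i ≠ j → c i ≠ 0 ∧ a i * b j - a j * b i ≠ 0 := by
    intro i j hij
    have h := bracket_ne_zero_of_factorDisc_ne_zero hD hij
    have e : bracket (α i, β i) (α j, β j) = c i * (c j * ((a i * b j - a j * b i : ℝ) : ℂ)) := by
      simp only [bracket, hα, hβ]; push_cast; ring
    rw [e] at h
    exact ⟨left_ne_zero_of_mul h,
      Complex.ofReal_ne_zero.1 (right_ne_zero_of_mul (right_ne_zero_of_mul h))⟩
  have hc0 := (hne (show (0 : Fin 3) ≠ 1 by decide)).1
  have hc1 := (hne (show (1 : Fin 3) ≠ 2 by decide)).1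
  have hc2 := (hne (show (2 : Fin 3) ≠ 0 by decide)).1
  have hD0 := (hne (show (0 : Fin 3) ≠ 1 by decide)).2
  have h02 := (hne (show (0 : Fin 3) ≠ 2 by decide)).2
  have h12 := (hne (show (1 : Fin 3) ≠ 2 by decide)).2
  set D := a 0 * b 1 - a 1 * b 0 with hDdef
  set P := -(a 1 * b 2 - a 2 * b 1) / D with hP
  set Q := (a 0 * b 2 - a 2 * b 0) / D with hQ
  have hP0 : P ≠ 0 := div_ne_zero (neg_ne_zero.2 h12) hD0
  have hQ0 : Q ≠ 0 := div_ne_zero h02 hD0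
  have ha2 : a 2 = P * a 0 + Q * a 1 := by
    rw [hP, hQ]; field_simp; rw [hDdef]; ring
  have hb2 : b 2 = P * b 0 + Q * b 1 := by
    rw [hP, hQ]; field_simp; rw [hDdef]; ring
  clear_value P Q
  -- The substitution is chosen so that the real forms `a i X - b i Y` become `X / P`, `-Y / Q` and,
  -- by the relation between them, `X - Y`.
  have hdet : (!![b 1 / (P * D), b 0 / (Q * D); a 1 / (P * D), a 0 / (Q * D)]).det ≠ 0 := by
    rw [Matrix.det_fin_two_of]
    have : b 1 / (P * D) * (a 0 / (Q * D)) - b 0 / (Q * D) * (a 1 / (P * D)) =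
        1 / (P * Q * D) := by
      field_simp; rw [hDdef]; ring
    rw [this]
    positivity
  have hPc : (P : ℂ) ≠ 0 := Complex.ofReal_ne_zero.2 hP0
  have hQc : (Q : ℂ) ≠ 0 := Complex.ofReal_ne_zero.2 hQ0
  have hDc : (D : ℂ) ≠ 0 := Complex.ofReal_ne_zero.2 hD0
  -- The scalar removes the factor `-1 / (P Q)` left by the substitution and the complex scalars `c
  -- i`.
  refine ⟨-(P * Q) / (c 0 * c 1 * c 2), by
    exact div_ne_zero (neg_ne_zero.2 (mul_ne_zero hPc hQc)) (by positivity),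
    Matrix.GeneralLinearGroup.mkOfDetNeZero _ hdet, ext_eval fun x y => ?_⟩
  rw [eval_formAct, hF, Fin.prod_univ_three]
  simp only [map_mul, map_sub, eval_C, eval_X, eval_linForm, hα, hβ]
  simp only [Matrix.GeneralLinearGroup.mkOfDetNeZero, Matrix.cons_val_zero, Matrix.cons_val_one,
    Matrix.GeneralLinearGroup.val_mk', Matrix.of_apply, Matrix.cons_val', Matrix.cons_val_fin_one]
  have e0 : (a 0 : ℂ) * (((b 1 / (P * D) : ℝ) : ℂ) * x + ((b 0 / (Q * D) : ℝ) : ℂ) * y) -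
      b 0 * (((a 1 / (P * D) : ℝ) : ℂ) * x + ((a 0 / (Q * D) : ℝ) : ℂ) * y) = x / P := by
    push_cast
    field_simp
    rw [hDdef]
    push_cast
    ring
  have e1 : (a 1 : ℂ) * (((b 1 / (P * D) : ℝ) : ℂ) * x + ((b 0 / (Q * D) : ℝ) : ℂ) * y) -
      b 1 * (((a 1 / (P * D) : ℝ) : ℂ) * x + ((a 0 / (Q * D) : ℝ) : ℂ) * y) = -y / Q := by
    push_cast
    field_simp
    rw [hDdef]
    push_cast
    ring
  set u := ((b 1 / (P * D) : ℝ) : ℂ) * x + ((b 0 / (Q * D) : ℝ) : ℂ) * y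
  set v := ((a 1 / (P * D) : ℝ) : ℂ) * x + ((a 0 / (Q * D) : ℝ) : ℂ) * y
  have e2 : (a 2 : ℂ) * u - b 2 * v = x - y := by
    rw [ha2, hb2]
    push_cast
    have e0' : (P : ℂ) * (a 0 * u - b 0 * v) = x := by rw [e0]; field_simp
    have e1' : (Q : ℂ) * (a 1 * u - b 1 * v) = -y := by rw [e1]; field_simp
    linear_combination e0' + e1'
  have e3 : (c 0 * a 0 * u - c 0 * b 0 * v) * (c 1 * a 1 * u - c 1 * b 1 * v) *
      (c 2 * a 2 * u - c 2 * b 2 * v) = c 0 * c 1 * c 2 * ((a 0 * u - b 0 * v) *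
        (a 1 * u - b 1 * v) * (a 2 * u - b 2 * v)) := by ring
  rw [e3, e0, e1, e2]
  field_simp

/-- A form which, up to a scalar, is equivalent to `XY(X - Y)` is a product of complex multiples of
real forms. -/
theorem exists_isRealMultiple_of_formEquiv {c : ℂ} (hc : c ≠ 0)
    (h : FormEquiv (C c * F) (X 0 * X 1 * (X 0 - X 1))) :
    ∃ α β : Fin 3 → ℂ, IsLinearFactorization F α β ∧ ∀ i, IsRealMultiple (α i, β i) := by
  obtain ⟨T, hT⟩ := h
  set S := T⁻¹ with hS
  have hmul : T.val * S.val = 1 := by rw [hS, ← Units.val_mul, mul_inv_cancel, Units.val_one]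
  have m : ∀ i j, T.val i 0 * S.val 0 j + T.val i 1 * S.val 1 j = (1 : Matrix _ _ ℝ) i j := by
    intro i j
    rw [← hmul, Matrix.mul_apply, Fin.sum_univ_two]
  have m' : ∀ i j, (T.val i 0 : ℂ) * S.val 0 j + T.val i 1 * S.val 1 j =
      (((1 : Matrix _ _ ℝ) i j : ℝ) : ℂ) := by
    intro i j
    rw [← m]; push_cast; rfl
  have m00 := m' 0 0
  have m01 := m' 0 1
  have m10 := m' 1 0
  have m11 := m' 1 1
  simp only [Matrix.one_apply_eq, Matrix.one_apply_ne (show (0 : Fin 2) ≠ 1 by decide),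
    Matrix.one_apply_ne (show (1 : Fin 2) ≠ 0 by decide), Complex.ofReal_one,
    Complex.ofReal_zero] at m00 m01 m10 m11
  -- Substituting `S` gives `c F = XY(X - Y) ∘ S`, so the factors come from the rows of `S` and
  -- their difference. The second coefficients change sign because `linForm a b` is `a X - b Y`; the
  -- scalar `c⁻¹` is put on the first factor.
  refine ⟨![c⁻¹ * (S.val 0 0 : ℝ), 1 * (S.val 1 0 : ℝ), 1 * (S.val 0 0 - S.val 1 0 : ℝ)],
    ![c⁻¹ * (-S.val 0 1 : ℝ), 1 * (-S.val 1 1 : ℝ), 1 * (-(S.val 0 1 - S.val 1 1) : ℝ)],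
    ext_eval fun x y => ?_, fun i => ?_⟩
  · have h1 := congrArg (eval ![(S.val 0 0 : ℂ) * x + (S.val 0 1 : ℂ) * y,
      (S.val 1 0 : ℂ) * x + (S.val 1 1 : ℂ) * y]) hT
    rw [eval_formAct] at h1
    have hx : (T.val 0 0 : ℂ) * ((S.val 0 0 : ℂ) * x + (S.val 0 1 : ℂ) * y) +
        (T.val 0 1 : ℂ) * ((S.val 1 0 : ℂ) * x + (S.val 1 1 : ℂ) * y) = x := by
      linear_combination x * m00 + y * m01
    have hy : (T.val 1 0 : ℂ) * ((S.val 0 0 : ℂ) * x + (S.val 0 1 : ℂ) * y) +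
        (T.val 1 1 : ℂ) * ((S.val 1 0 : ℂ) * x + (S.val 1 1 : ℂ) * y) = y := by
      linear_combination x * m10 + y * m11
    rw [hx, hy] at h1
    simp only [map_mul, map_sub, eval_C, eval_X, Matrix.cons_val_zero, Matrix.cons_val_one] at h1
    rw [Fin.prod_univ_three]
    simp only [map_mul, eval_linForm, Matrix.cons_val_zero, Matrix.cons_val_one, Matrix.cons_val]
    push_cast
    apply mul_left_cancel₀ hc
    rw [← h1]
    field_simp
    ring
  · fin_cases i
    · exact ⟨c⁻¹, _, _, rfl⟩
    · exact ⟨1, _, _, rfl⟩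
    · exact ⟨1, _, _, rfl⟩

end Cubic

/-- For a binary form `F` of degree `n ≥ 3` with complex coefficients and `D_F ≠ 0`,
`|D_F|^{1/(n(n-1))} A_F ≤ 3 B(1/3, 1/3)`, with equality precisely when `F` is a cubic form which,
up to multiplication by a complex number, is equivalent under `GL₂(ℝ)` to `XY(X - Y)`.
The inequality is between extended non-negative reals, so it contains that `A_F` is finite. -/
theorem theorem2 (n : ℕ) (hn : 3 ≤ n) (F : MvPolynomial (Fin 2) ℂ) (hF : F.IsHomogeneous n)
    (hD : formDisc n F ≠ 0) :
    ENNReal.ofReal (‖formDisc n F‖ ^ (1 / ((n : ℝ) * ((n : ℝ) - 1)))) * formArea F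
        ≤ ENNReal.ofReal (3 * ProbabilityTheory.beta (1 / 3) (1 / 3)) ∧
      (ENNReal.ofReal (‖formDisc n F‖ ^ (1 / ((n : ℝ) * ((n : ℝ) - 1)))) * formArea F
          = ENNReal.ofReal (3 * ProbabilityTheory.beta (1 / 3) (1 / 3)) ↔
        n = 3 ∧ ∃ c : ℂ, c ≠ 0 ∧
          FormEquiv (C c * F) (X 0 * X 1 * (X 0 - X 1))) := by
  have hn2 : 2 ≤ n := by omega
  obtain ⟨α, β, hfac⟩ := exists_isLinearFactorization (by omega) hF
  have hfD : factorDisc α β ≠ 0 := by rwa [← formDisc_eq hn2 hfac]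
  have harea := ofReal_mul_formArea_eq_lintegral hn2 hfac hfD
  refine ⟨?_, fun heq => ?_, ?_⟩
  · rw [harea]
    exact (lintegral_areaKernel_le_meanKernel hn hfD).trans (lintegral_meanKernel_le hn α β)
  · have hge := (harea.symm.trans heq).ge
    obtain rfl := eq_three_of_le_lintegral_areaKernel hn hfD hge
    exact ⟨rfl, exists_formEquiv_of_isRealMultiple hfac hfD
      (isRealMultiple_of_le_lintegral_areaKernel hn hfD hge)⟩
  · rintro ⟨rfl, c, hc, hequiv⟩
    -- The discriminant and the area do not depend on the factorization, so the one with factors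
    -- that are multiples of real forms may be used.
    obtain ⟨α', β', hfac', hreal⟩ := exists_isRealMultiple_of_formEquiv hc hequiv
    have hfD' : factorDisc α' β' ≠ 0 := by rwa [← formDisc_eq hn2 hfac']
    rw [ofReal_mul_formArea_eq_lintegral hn2 hfac' hfD']
    simp only [areaKernel_three]
    exact tripleMass_of_isRealMultiple (hreal 0) (hreal 1) (hreal 2)
      (bracket_ne_zero_of_factorDisc_ne_zero hfD' (by decide))
      (bracket_ne_zero_of_factorDisc_ne_zero hfD' (by decide))
      (bracket_ne_zero_of_factorDisc_ne_zero hfD' (by decide))
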